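/- A polytope in $\mathbb{R}^d$ is a finite union $S$ of convex polytopes with non-empty interior; it need be neither convex nor connected. Its $(d-1)$-dimensional faces are the closures of the connected components of the set of those points $x$ near which $S$ coincides with a closed half-space having $x$ on its bounding hyperplane. Its vertices are the points $x \in S$ such that for no $u \neq 0$ is $S$, near $x$, invariant under all small translations $y \mapsto y + tu$. (For a convex $S$ these are the usual facets and vertices.) A set is centrally symmetric if it is symmetric about some point of $\mathbb{R}^d$. A lattice is the image of $\mathbb{Z}^d$ under an invertible linear transformation of $\mathbb{R}^d$. Let $S \subset \mathbb{R}^d$ be a centrally symmetric polytope whose $(d-1)$-dimensional faces are also centrally symmetric and whose vertices all lie in some lattice $L$. Then $S$ admits a Riesz basis of exponentials: there is a set $\Gamma \subset \mathbb{R}^d$ such that, with $e_\gamma(x) = e^{2\pi i \langle \gamma, x\rangle}$, the mapping $$f \mapsto \left( \int_S f(x)\, \overline{e_\gamma(x)}\, dx \right)_{\gamma \in \Gamma}$$ is a bounded and invertible linear map from $L^2(S)$ onto $\ell^2(\Gamma)$. -/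

import Mathlib

open MeasureTheory Filter Topology

noncomputable section

namespace RieszExp

/-- `ℝ^d` with its Euclidean structure. -/
abbrev Space (d : ℕ) : Type := EuclideanSpace ℝ (Fin d)

/-- The exponential `e_l(x) = exp(2 π i ⟨l, x⟩)`. -/
def expFun {d : ℕ} (l x : Space d) : ℂ :=
  Complex.exp (2 * (Real.pi : ℂ) * Complex.I * ((inner ℝ l x : ℝ) : ℂ))

/-- `E(Γ) = {e_l : l ∈ Γ}` is a Riesz basis for `S`: the map `f ↦ (⟨f, e_l⟩)_{l ∈ Γ}` is a bounded
invertible linear map of `L²(S)` onto `ℓ²(Γ)`. -/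
def IsRieszBasisOfExponentials {d : ℕ} (S Γ : Set (Space d)) : Prop :=
  ∃ T : Lp ℂ 2 ((volume : Measure (Space d)).restrict S) ≃L[ℂ] lp (fun _ : Γ => ℂ) 2,
    ∀ (f : Lp ℂ 2 ((volume : Measure (Space d)).restrict S)) (l : Γ),
      (T f : Γ → ℂ) l = ∫ x in S, f x * (starRingEnd ℂ) (expFun (l : Space d) x)

/-- A (not necessarily convex) polytope in `ℝ^d`: a finite union of `d`-dimensional convex
polytopes, each of them the convex hull of a finite set. -/
def IsPolytope {d : ℕ} (S : Set (Space d)) : Prop :=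
  ∃ 𝒱 : Finset (Finset (Space d)),
    (∀ V ∈ 𝒱, (interior (convexHull ℝ (V : Set (Space d)))).Nonempty) ∧
    S = ⋃ V ∈ 𝒱, convexHull ℝ (V : Set (Space d))

/-- Symmetry about some point `c`, not necessarily the origin. -/
def IsCentrallySymmetric {d : ℕ} (A : Set (Space d)) : Prop :=
  ∃ c : Space d, ∀ x ∈ A, Equiv.pointReflection c x ∈ A

/-- The points at which the boundary of `S` is flat: near `x`, the set `S` is a closed half-space
with `x` on its bounding hyperplane. -/
def flatBoundary {d : ℕ} (S : Set (Space d)) : Set (Space d) :=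
  {x | ∃ n : Space d, n ≠ 0 ∧ ∀ᶠ y in 𝓝 x, (y ∈ S ↔ inner ℝ n (y - x) ≤ (0 : ℝ))}

/-- The `(d-1)`-dimensional faces of a polytope `S` in `ℝ^d`: the closures of the maximal connected
flat pieces of its boundary. Such a piece lies in one hyperplane, and `S` lies locally on one side
of it. -/
def IsFacet {d : ℕ} (S F : Set (Space d)) : Prop :=
  ∃ x ∈ flatBoundary S, F = closure (connectedComponentIn (flatBoundary S) x)

/-- The vertices (zero-dimensional faces) of a polytope `S`: the points of `S` near which `S` is not
invariant under small translations along any line. -/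
def IsVertex {d : ℕ} (S : Set (Space d)) (x : Space d) : Prop :=
  x ∈ S ∧ ∀ u : Space d,
    (∀ᶠ p : Space d × ℝ in 𝓝 (x, 0), (p.1 + p.2 • u ∈ S ↔ p.1 ∈ S)) → u = 0

end RieszExp

end

/-!
The proof has two independent halves, joined by the notion of a multi-tile: a set whose translates
by the lattice `L` cover almost every point the same number `k` of times.

*A multi-tile has a Riesz basis of exponentials.* Choose a vector `a` such that `e_a` is injective
on `L`, and let the frequencies be `γ + j a` with `γ` in the dual lattice and `0 ≤ j < k`. Fold
integrals over `S` into a fundamental domain `D` of `L`. For almost every `x ∈ D` there are exactly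
`k` lattice vectors `l` with `l + x ∈ S`, and at these points a combination of the exponentials
takes the values `∑ j, z j * w l ^ j`, where `w l = e_a(l)` and `‖z j‖` is the modulus at `x` of an
`L`-periodic trigonometric polynomial `G j`. The `w l` are distinct and, `S` being bounded, only
finitely many sets of them occur, so Vandermonde matrices give
`∑ l, ‖∑ j, z j * w l ^ j‖ ^ 2 ≍ ∑ j, ‖G j x‖ ^ 2` uniformly in `x`. Integrating, by Parseval on
`D`, yields the two-sided Riesz bounds (`exists_riesz_bounds`). Conversely, if `f` is orthogonal to
all the exponentials, then uniqueness of Fourier series on `D` shows that the `k` folded functions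
`∑ l, f (l + x) * conj (e_a (l + x)) ^ j` vanish, and the same Vandermonde matrices give `f = 0`
(`ae_eq_zero_of_forall_setIntegral_mul_conj_expFun`). A complete family with two-sided Riesz bounds
is a Riesz basis (`exists_analysisEquiv`).

*The polytope is a multi-tile.* The boundary of `S` lies in finitely many hyperplanes, and a
boundary point on only one of them is flat (`mem_flatBoundary_of_unique_hyperplane`). Hence almost every
segment avoids the lattice translates of the non-flat boundary points, which have codimension two,
and it is enough that the covering multiplicity does not change when such a segment crosses the
translated boundary (`eventually_coverCount_eq`). There the jumps cancel in pairs: if the facet `F`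
is symmetric about `c_F` and `S` about `c_S`, then translation by `t = 2 c_S - 2 c_F` carries `F` to
the opposite facet, on which `S` lies on the other side (`facet_translation`). Moreover `t` is a
lattice vector. Indeed an extreme point `v` of `F` is a vertex of `S`
(`isVertex_of_mem_extremePoints`), so `2 c_S - v` and `2 c_F - v` are vertices, and `t` is their
difference.
-/

namespace RieszExp

/-! ### Riesz bases in Hilbert spaces -/

section Hilbert

variable {H I : Type*} [NormedAddCommGroup H] [InnerProductSpace ℂ H]

open scoped InnerProductSpace

/-- Bessel's inequality, dual to the upper Riesz bound. -/
lemma sum_norm_inner_sq_le {v : I → H} {B : ℝ} (hB : 0 ≤ B)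
    (hup : ∀ (s : Finset I) (c : I → ℂ), ‖∑ i ∈ s, c i • v i‖ ^ 2 ≤ B * ∑ i ∈ s, ‖c i‖ ^ 2)
    (f : H) (s : Finset I) : ∑ i ∈ s, ‖⟪v i, f⟫_ℂ‖ ^ 2 ≤ B * ‖f‖ ^ 2 := by
  set q := ∑ i ∈ s, ‖⟪v i, f⟫_ℂ‖ ^ 2 with hq
  have hq0 : 0 ≤ q := by positivity
  have h1 : ((q : ℝ) : ℂ) = ⟪∑ i ∈ s, ⟪v i, f⟫_ℂ • v i, f⟫_ℂ := by
    rw [sum_inner, hq]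
    push_cast
    refine Finset.sum_congr rfl fun i _ => ?_
    rw [inner_smul_left, Complex.conj_mul']
  have h2 : q ≤ ‖∑ i ∈ s, ⟪v i, f⟫_ℂ • v i‖ * ‖f‖ := by
    have := norm_inner_le_norm (𝕜 := ℂ) (∑ i ∈ s, ⟪v i, f⟫_ℂ • v i) f
    rw [← h1, Complex.norm_real, Real.norm_of_nonneg hq0] at this
    exact this
  have h3 := hup s fun i => ⟪v i, f⟫_ℂ
  have h4 : q ^ 2 ≤ (B * q) * ‖f‖ ^ 2 := by
    calc q ^ 2 ≤ (‖∑ i ∈ s, ⟪v i, f⟫_ℂ • v i‖ * ‖f‖) ^ 2 := by gcongr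
      _ = ‖∑ i ∈ s, ⟪v i, f⟫_ℂ • v i‖ ^ 2 * ‖f‖ ^ 2 := by ring
      _ ≤ (B * q) * ‖f‖ ^ 2 := by gcongr
  rcases hq0.eq_or_lt with h0 | h0
  · rw [← h0]; positivity
  · have : q * q ≤ q * (B * ‖f‖ ^ 2) := by nlinarith
    exact le_of_mul_le_mul_left this h0

lemma exists_analysisOperator {v : I → H} {B : ℝ} (hB : 0 ≤ B)
    (hup : ∀ (s : Finset I) (c : I → ℂ), ‖∑ i ∈ s, c i • v i‖ ^ 2 ≤ B * ∑ i ∈ s, ‖c i‖ ^ 2) :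
    ∃ T : H →L[ℂ] lp (fun _ : I => ℂ) 2, ∀ f i, (T f : I → ℂ) i = ⟪v i, f⟫_ℂ := by
  have hmem : ∀ f : H, Memℓp (fun i => ⟪v i, f⟫_ℂ) 2 := fun f => by
    refine memℓp_gen' (C := B * ‖f‖ ^ 2) fun s => ?_
    simpa using sum_norm_inner_sq_le hB hup f s
  let T : H →ₗ[ℂ] lp (fun _ : I => ℂ) 2 :=
    { toFun := fun f => ⟨fun i => ⟪v i, f⟫_ℂ, hmem f⟩
      map_add' := fun f g => by ext i; exact inner_add_right _ _ _
      map_smul' := fun c f => by ext i; exact inner_smul_right _ _ _ }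
  refine ⟨T.mkContinuous (√B) fun f => ?_, fun f i => rfl⟩
  refine lp.norm_le_of_forall_sum_le (by norm_num) (by positivity) fun s => ?_
  have := sum_norm_inner_sq_le hB hup f s
  simp only [ENNReal.toReal_ofNat, Real.rpow_ofNat, mul_pow, Real.sq_sqrt hB]
  exact this

/-- A complete family in a Hilbert space satisfying two-sided Riesz bounds on finite linear
combinations has an invertible analysis operator. The operator is bounded by the upper bound; its
adjoint, the synthesis operator, is bounded below and has dense range, hence is invertible. -/
theorem exists_analysisEquiv [CompleteSpace H] {v : I → H} {A B : ℝ} (hB : 0 ≤ B)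
    (hlow : ∀ (s : Finset I) (c : I → ℂ), ∑ i ∈ s, ‖c i‖ ^ 2 ≤ A * ‖∑ i ∈ s, c i • v i‖ ^ 2)
    (hup : ∀ (s : Finset I) (c : I → ℂ), ‖∑ i ∈ s, c i • v i‖ ^ 2 ≤ B * ∑ i ∈ s, ‖c i‖ ^ 2)
    (hcomplete : ∀ f : H, (∀ i, ⟪v i, f⟫_ℂ = 0) → f = 0) :
    ∃ T : H ≃L[ℂ] lp (fun _ : I => ℂ) 2, ∀ f i, (T f : I → ℂ) i = ⟪v i, f⟫_ℂ := by
  classical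
  obtain ⟨T, hT⟩ := exists_analysisOperator hB hup
  set V := ContinuousLinearMap.adjoint T with hV
  have hVsingle : ∀ i (a : ℂ), V (lp.single 2 i a) = a • v i := fun i a => by
    refine ext_inner_right ℂ fun f => ?_
    rw [hV, ContinuousLinearMap.adjoint_inner_left, lp.inner_single_left, hT, inner_smul_left]
    simp [mul_comm]
  have hbound : ∀ c : lp (fun _ : I => ℂ) 2, ‖c‖ ^ 2 ≤ A * ‖V c‖ ^ 2 := fun c => by
    have hs := lp.hasSum_single (by norm_num : (2 : ENNReal) ≠ ⊤) c
    have h1 := (hs.norm.pow 2)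
    have h2 := (((V.continuous.tendsto c).comp hs).norm.pow 2).const_mul A
    refine le_of_tendsto_of_tendsto' h1 h2 fun s => ?_
    have h3 := lp.norm_sum_single (p := 2) (by norm_num) (fun i => (c : I → ℂ) i) s
    simp only [ENNReal.toReal_ofNat, Real.rpow_ofNat] at h3
    simp only [Function.comp_apply, map_sum, hVsingle]
    rw [h3]
    exact hlow s _
  have hanti : AntilipschitzWith (Real.toNNReal (√A)) V := by
    refine AddMonoidHomClass.antilipschitz_of_bound V fun c => ?_
    rw [Real.coe_toNNReal _ (Real.sqrt_nonneg _)]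
    refine (le_of_abs_le (Real.abs_le_sqrt (hbound c))).trans ?_
    rcases le_or_gt 0 A with hA | hA
    · rw [Real.sqrt_mul hA, Real.sqrt_sq (norm_nonneg _)]
    · rw [Real.sqrt_eq_zero_of_nonpos (by nlinarith [sq_nonneg ‖V c‖])]
      positivity
  have hclosed : IsClosed (Set.range V) := hanti.isClosed_range V.uniformContinuous
  have hsurj : LinearMap.range V.toLinearMap = ⊤ := by
    have hc : IsClosed ((LinearMap.range V.toLinearMap : Submodule ℂ H) : Set H) := hclosed
    have : CompleteSpace (LinearMap.range V.toLinearMap) := hc.completeSpace_coe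
    rw [← Submodule.orthogonal_eq_bot_iff, Submodule.eq_bot_iff]
    intro f hf
    refine hcomplete f fun i => ?_
    have := (Submodule.mem_orthogonal _ f).1 hf (V (lp.single 2 i 1)) ⟨_, rfl⟩
    rwa [hVsingle, one_smul] at this
  let E := ContinuousLinearEquiv.ofBijective V
    (LinearMap.ker_eq_bot.2 hanti.injective) hsurj
  have hE : ∀ c, E c = V c := fun c => rfl
  set W : H →L[ℂ] lp (fun _ : I => ℂ) 2 := E.symm.toContinuousLinearMap
  have hTV : T = ContinuousLinearMap.adjoint V := (ContinuousLinearMap.adjoint_adjoint T).symm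
  have h1 : V ∘L W = ContinuousLinearMap.id ℂ H := by
    ext f; exact E.apply_symm_apply f
  have h2 : W ∘L V = ContinuousLinearMap.id ℂ _ := by
    refine ContinuousLinearMap.ext fun c => E.symm_apply_apply c
  refine ⟨ContinuousLinearEquiv.equivOfInverse T (ContinuousLinearMap.adjoint W)
    (fun f => ?_) (fun c => ?_), fun f i => hT f i⟩
  · have := congrArg ContinuousLinearMap.adjoint h1
    rw [ContinuousLinearMap.adjoint_comp, ← hTV, ContinuousLinearMap.adjoint_id] at this
    exact congrArg (· f) this
  · have := congrArg ContinuousLinearMap.adjoint h2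
    rw [ContinuousLinearMap.adjoint_comp, ← hTV, ContinuousLinearMap.adjoint_id] at this
    exact congrArg (· c) this

end Hilbert

/-! ### Exponentials -/

section Exponentials

variable {d : ℕ}

lemma expFun_add_left (l l' x : Space d) : expFun (l + l') x = expFun l x * expFun l' x := by
  simp only [expFun, inner_add_left, ← Complex.exp_add]
  congr 1; push_cast; ring

lemma expFun_add_right (l x y : Space d) : expFun l (x + y) = expFun l x * expFun l y := by
  simp only [expFun, inner_add_right, ← Complex.exp_add]
  congr 1; push_cast; ring

lemma expFun_zero_left (x : Space d) : expFun 0 x = 1 := by simp [expFun]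

lemma expFun_nsmul_left (j : ℕ) (l x : Space d) : expFun (j • l) x = expFun l x ^ j := by
  induction j with
  | zero => simp [expFun_zero_left]
  | succ j ih => rw [succ_nsmul, expFun_add_left, ih, pow_succ]

lemma norm_expFun (l x : Space d) : ‖expFun l x‖ = 1 := by
  rw [expFun, show 2 * (Real.pi : ℂ) * Complex.I * ((inner ℝ l x : ℝ) : ℂ)
    = ((2 * Real.pi * inner ℝ l x : ℝ) : ℂ) * Complex.I by push_cast; ring]
  exact Complex.norm_exp_ofReal_mul_I _

lemma continuous_expFun (l : Space d) : Continuous (expFun l) := by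
  unfold expFun; fun_prop

lemma expFun_neg_left (l x : Space d) : expFun (-l) x = (starRingEnd ℂ) (expFun l x) := by
  simp only [expFun, ← Complex.exp_conj]
  congr 1; simp [Complex.conj_ofNat]

lemma expFun_eq_one_iff (l x : Space d) : expFun l x = 1 ↔ ∃ m : ℤ, inner ℝ l x = (m : ℝ) := by
  rw [expFun, Complex.exp_eq_one_iff]
  have h : (2 * (Real.pi : ℂ) * Complex.I) ≠ 0 := Complex.two_pi_I_ne_zero
  refine exists_congr fun m => ?_
  rw [mul_comm ((m : ℤ) : ℂ), mul_right_inj' h]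
  norm_cast

lemma volume_hyperplane {n : Space d} (hn : n ≠ 0) (c : ℝ) :
    volume {x : Space d | inner ℝ n x = c} = 0 := by
  let A : AffineSubspace ℝ (Space d) := AffineSubspace.mk' (((c / ‖n‖ ^ 2) • n)) (ℝ ∙ n)ᗮ
  have hn' : ‖n‖ ^ 2 ≠ 0 := by positivity
  have hA : {x : Space d | inner ℝ n x = c} = A := by
    ext x
    simp only [Set.mem_ofPred_eq, A, SetLike.mem_coe, AffineSubspace.mem_mk',
      Submodule.mem_orthogonal_singleton_iff_inner_right, vsub_eq_sub, inner_sub_right,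
      inner_smul_right, real_inner_self_eq_norm_sq]
    rw [div_mul_cancel₀ _ hn', sub_eq_zero]
  rw [hA]
  refine Measure.addHaar_affineSubspace _ _ fun h => ?_
  have h1 : ((c / ‖n‖ ^ 2) • n + n) ∈ (A : Set (Space d)) := by rw [h]; trivial
  rw [← hA] at h1
  simp only [Set.mem_ofPred_eq, inner_add_right, inner_smul_right,
    real_inner_self_eq_norm_sq, div_mul_cancel₀ _ hn'] at h1
  exact hn' (by linarith)

/-- A generic frequency separates the points of a countable set: by countability, the frequencies
that fail to do so lie in a countable union of hyperplanes. -/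
lemma exists_expFun_injOn {s : Set (Space d)} (hs : s.Countable) :
    ∃ a : Space d, Set.InjOn (expFun a) s := by
  have h : ∀ᵐ a : Space d, ∀ x ∈ s, ∀ y ∈ s, x ≠ y → ∀ m : ℤ, inner ℝ (x - y) a ≠ (m : ℝ) := by
    refine (ae_ball_iff hs).2 fun x _ => (ae_ball_iff hs).2 fun y _ => ?_
    by_cases hxy : x = y
    · simp [hxy]
    · simp only [ne_eq, hxy, not_false_eq_true, forall_const]
      refine ae_all_iff.2 fun m => ?_
      have := volume_hyperplane (sub_ne_zero.2 hxy) (m : ℝ)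
      exact compl_mem_ae_iff.2 this
  obtain ⟨a, ha⟩ := h.exists
  refine ⟨a, fun x hx y hy hxy => ?_⟩
  by_contra hne
  have h1 : expFun a (x - y) = 1 := by
    have h2 : expFun a x = expFun a (x - y) * expFun a y := by
      rw [← expFun_add_right, sub_add_cancel]
    have h3 : expFun a y ≠ 0 := by
      rw [← norm_ne_zero_iff, norm_expFun]; norm_num
    rw [hxy] at h2
    exact (mul_right_cancel₀ h3 (by rw [one_mul]; exact h2)).symm
  obtain ⟨m, hm⟩ := (expFun_eq_one_iff _ _).1 h1
  exact ha x hx y hy hne m (by rw [real_inner_comm]; exact hm)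

end Exponentials

/-! ### Fourier series on a fundamental domain -/

section DualLattice

open Module

instance {d : ℕ} (L : Submodule ℤ (Space d)) :
    VAddInvariantMeasure L (Space d) (volume : Measure (Space d)) :=
  ⟨fun c s _ => measure_preimage_add volume (c : Space d) s⟩

variable {d : ℕ} {ι : Type*} (b : Basis ι ℝ (Space d))

/-- The quotient map onto the torus, in the coordinates given by the basis `b`. -/
noncomputable def torusMap (x : Space d) : UnitAddTorus ι :=
  fun i => ((b.repr x i : ℝ) : UnitAddCircle)

lemma continuous_torusMap : Continuous (torusMap b) := by
  refine continuous_pi fun i => (AddCircle.continuous_mk' 1).comp ?_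
  exact (LinearMap.continuous_of_finiteDimensional (b.coord i))

lemma injOn_torusMap : Set.InjOn (torusMap b) (ZSpan.fundamentalDomain b) := by
  intro x hx y hy hxy
  refine b.ext_elem fun i => ?_
  have h := congrFun hxy i
  have := (AddCircle.coe_eq_coe_iff_of_mem_Ico (p := (1 : ℝ)) (a := 0) (hp := ⟨one_pos⟩)
    (x := b.repr x i) (y := b.repr y i) (by simpa using hx i) (by simpa using hy i)).1 h
  exact this

variable [Fintype ι]

/-- The vector of the dual lattice with integer coordinates `n`: pairing with it is the linear form
`x ↦ ∑ i, n i * xᵢ`, where `xᵢ` are the coordinates of `x` in the basis `b`. -/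
noncomputable def dualVec (n : ι → ℤ) : Space d :=
  (InnerProductSpace.toDual ℝ (Space d)).symm
    (LinearMap.toContinuousLinearMap (∑ i, (n i : ℝ) • b.coord i))

lemma inner_dualVec (n : ι → ℤ) (x : Space d) :
    inner ℝ (dualVec b n) x = ∑ i, (n i : ℝ) * b.repr x i := by
  rw [dualVec, InnerProductSpace.toDual_symm_apply]
  simp

lemma dualVec_sub (m n : ι → ℤ) : dualVec b (m - n) = dualVec b m - dualVec b n := by
  refine ext_inner_right ℝ fun x => ?_
  simp only [inner_sub_left, inner_dualVec, Pi.sub_apply, Int.cast_sub, sub_mul,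
    Finset.sum_sub_distrib]

lemma dualVec_zero : dualVec b 0 = 0 := by
  simpa using dualVec_sub b 0 0

lemma expFun_dualVec_lattice (n : ι → ℤ) (l : Submodule.span ℤ (Set.range b)) :
    expFun (dualVec b n) (l : Space d) = 1 := by
  rw [expFun_eq_one_iff]
  have h := (b.mem_span_iff_repr_mem ℤ (l : Space d)).1 l.2
  choose m hm using h
  refine ⟨∑ i, n i * m i, ?_⟩
  rw [inner_dualVec]
  push_cast
  refine Finset.sum_congr rfl fun i _ => ?_
  rw [← hm i]; simp

lemma expFun_dualVec_vadd (n : ι → ℤ) (l : Submodule.span ℤ (Set.range b)) (x : Space d) :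
    expFun (dualVec b n) (l +ᵥ x) = expFun (dualVec b n) x := by
  rw [Submodule.vadd_def, vadd_eq_add, expFun_add_right, expFun_dualVec_lattice, one_mul]

lemma exists_expFun_dualVec_ne_one {n : ι → ℤ} (hn : n ≠ 0) :
    ∃ u, expFun (dualVec b n) u ≠ 1 := by
  classical
  obtain ⟨i, hi⟩ := Function.ne_iff.1 hn
  have hi' : (n i : ℝ) ≠ 0 := by exact_mod_cast hi
  refine ⟨(1 / (2 * (n i : ℝ))) • b i, fun h => ?_⟩
  obtain ⟨m, hm⟩ := (expFun_eq_one_iff _ _).1 h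
  rw [inner_dualVec, Finset.sum_eq_single i] at hm
  · simp only [map_smul, Finsupp.smul_apply, Basis.repr_self, Finsupp.single_eq_same,
      smul_eq_mul, mul_one] at hm
    have : (2 * m : ℝ) = 1 := by rw [← hm]; field_simp
    have h2 : (2 * m : ℤ) = 1 := by exact_mod_cast this
    omega
  · intro j _ hj
    simp [Finsupp.single_eq_of_ne hj]
  · simp

lemma volume_fundamentalDomain_lt_top :
    volume (ZSpan.fundamentalDomain b) < ⊤ :=
  (ZSpan.fundamentalDomain_isBounded b).measure_lt_top

/-- A nontrivial lattice-periodic character has zero mean: translating by `u` multiplies the mean by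
the value of the character at `u`. -/
lemma setIntegral_expFun_dualVec {n : ι → ℤ} (hn : n ≠ 0) :
    ∫ x in ZSpan.fundamentalDomain b, expFun (dualVec b n) x = 0 := by
  obtain ⟨u, hu⟩ := exists_expFun_dualVec_ne_one b hn
  have hD := ZSpan.isAddFundamentalDomain b (volume : Measure (Space d))
  have h1 := hD.setIntegral_eq (hD.vadd_of_comm u) (f := expFun (dualVec b n))
    (expFun_dualVec_vadd b n)
  have h2 := (measurePreserving_vadd u (volume : Measure (Space d))).setIntegral_image_emb
    (measurableEmbedding_const_vadd u) (expFun (dualVec b n)) (ZSpan.fundamentalDomain b)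
  rw [Set.image_vadd] at h2
  rw [h2] at h1
  simp only [vadd_eq_add, expFun_add_right, integral_const_mul] at h1
  by_contra h0
  exact hu (mul_right_cancel₀ h0 (by rw [one_mul]; exact h1.symm))

lemma setIntegral_norm_sq_sum_expFun (t : Finset (ι → ℤ)) (c : (ι → ℤ) → ℂ) :
    ∫ x in ZSpan.fundamentalDomain b, ‖∑ n ∈ t, c n * expFun (dualVec b n) x‖ ^ 2
      = volume.real (ZSpan.fundamentalDomain b) * ∑ n ∈ t, ‖c n‖ ^ 2 := by
  classical
  have hfin : IsFiniteMeasure (volume.restrict (ZSpan.fundamentalDomain b)) :=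
    ⟨by rw [Measure.restrict_apply_univ]; exact volume_fundamentalDomain_lt_top b⟩
  have hint : ∀ n, Integrable (expFun (dualVec b n))
      (volume.restrict (ZSpan.fundamentalDomain b)) := fun n =>
    Integrable.of_bound (continuous_expFun _).aestronglyMeasurable 1
      (Eventually.of_forall fun x => (norm_expFun _ x).le)
  have h1 : ∀ x, ((‖∑ n ∈ t, c n * expFun (dualVec b n) x‖ ^ 2 : ℝ) : ℂ)
      = ∑ m ∈ t, ∑ n ∈ t, (starRingEnd ℂ (c m) * c n) * expFun (dualVec b (n - m)) x := by
    intro x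
    push_cast
    rw [← Complex.conj_mul', map_sum, Finset.sum_mul_sum]
    refine Finset.sum_congr rfl fun m _ => Finset.sum_congr rfl fun n _ => ?_
    rw [dualVec_sub, sub_eq_add_neg, expFun_add_left, expFun_neg_left, map_mul]
    ring
  have h2 : ∀ m n, ∫ x in ZSpan.fundamentalDomain b,
      (starRingEnd ℂ (c m) * c n) * expFun (dualVec b (n - m)) x
      = if m = n then ((volume.real (ZSpan.fundamentalDomain b) : ℝ) : ℂ) * (‖c m‖ ^ 2 : ℝ)
        else 0 := by
    intro m n
    rw [integral_const_mul]
    split_ifs with h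
    · subst h
      simp only [sub_self, dualVec_zero, expFun_zero_left, integral_const,
        MeasurableSet.univ, measureReal_restrict_apply, Set.univ_inter, Complex.real_smul, mul_one]
      rw [Complex.conj_mul']
      push_cast; ring
    · rw [setIntegral_expFun_dualVec b (sub_ne_zero.2 (Ne.symm h)), mul_zero]
  have h3 : ((∫ x in ZSpan.fundamentalDomain b,
      ‖∑ n ∈ t, c n * expFun (dualVec b n) x‖ ^ 2 : ℝ) : ℂ)
      = ((volume.real (ZSpan.fundamentalDomain b) * ∑ n ∈ t, ‖c n‖ ^ 2 : ℝ) : ℂ) := by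
    rw [← integral_complex_ofReal]
    simp_rw [h1]
    rw [integral_finsetSum _ fun m _ => integrable_finsetSum _ fun n _ => (hint _).const_mul _]
    simp_rw [integral_finsetSum t fun n _ => (hint _).const_mul _, h2]
    rw [Finset.sum_congr rfl fun m hm => by rw [Finset.sum_ite_eq, if_pos hm], ← Finset.mul_sum]
    push_cast; rfl
  exact_mod_cast h3

lemma mFourier_torusMap (n : ι → ℤ) (x : Space d) :
    UnitAddTorus.mFourier n (torusMap b x) = expFun (dualVec b n) x := by
  rw [expFun, inner_dualVec]
  simp only [UnitAddTorus.mFourier, torusMap, ContinuousMap.coe_mk, fourier_coe_apply]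
  rw [← Complex.exp_sum]
  congr 1
  push_cast
  rw [Finset.mul_sum]
  refine Finset.sum_congr rfl fun i _ => ?_
  ring

/-- An integrable function on the fundamental domain whose Fourier coefficients all vanish is zero.
Density of trigonometric polynomials in the continuous functions on the torus gives orthogonality
to all continuous periodic functions, and by approximation to indicators of Borel subsets of the
torus; as the quotient map is injective on the fundamental domain, these pull back to all of its
Borel subsets. -/
lemma ae_eq_zero_of_forall_setIntegral_mul_expFun {F : Space d → ℂ}
    (hF : IntegrableOn F (ZSpan.fundamentalDomain b))
    (h : ∀ n, ∫ x in ZSpan.fundamentalDomain b, F x * expFun (dualVec b n) x = 0) :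
    ∀ᵐ x ∂volume.restrict (ZSpan.fundamentalDomain b), F x = 0 := by
  set D := ZSpan.fundamentalDomain b with hDdef
  have hDm : MeasurableSet D := ZSpan.fundamentalDomain_measurableSet b
  set ν := volume.restrict D with hν
  have hπ := continuous_torusMap b
  have hmul : ∀ φ : C(UnitAddTorus ι, ℂ), Integrable (fun x => F x * φ (torusMap b x)) ν := by
    intro φ
    refine hF.mul_bdd (c := ‖φ‖) ?_ ?_
    · exact (φ.continuous.comp hπ).aestronglyMeasurable
    · exact Eventually.of_forall fun x => φ.norm_coe_le_norm _
  have hcont : ∀ φ : C(UnitAddTorus ι, ℂ), ∫ x, F x * φ (torusMap b x) ∂ν = 0 := by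
    let Φ : C(UnitAddTorus ι, ℂ) →ₗ[ℂ] ℂ :=
      { toFun := fun φ => ∫ x, F x * φ (torusMap b x) ∂ν
        map_add' := fun φ ψ => by
          rw [← integral_add (hmul φ) (hmul ψ)]
          simp only [ContinuousMap.add_apply, mul_add]
        map_smul' := fun c φ => by
          rw [RingHom.id_apply, smul_eq_mul, ← integral_const_mul]
          congr 1; ext x
          simp only [ContinuousMap.smul_apply, smul_eq_mul]; ring }
    let Φ' : C(UnitAddTorus ι, ℂ) →L[ℂ] ℂ := Φ.mkContinuous (∫ x, ‖F x‖ ∂ν) fun φ => by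
      rw [← integral_mul_const]
      refine norm_integral_le_of_norm_le (hF.norm.mul_const _) (Eventually.of_forall fun x => ?_)
      rw [norm_mul]
      gcongr
      exact φ.norm_coe_le_norm _
    have hker : (Submodule.span ℂ (Set.range (UnitAddTorus.mFourier (d := ι)))).topologicalClosure
        ≤ LinearMap.ker Φ'.toLinearMap := by
      refine Submodule.topologicalClosure_minimal _ ?_ Φ'.isClosed_ker
      rw [Submodule.span_le]
      rintro _ ⟨n, rfl⟩
      change ∫ x, F x * UnitAddTorus.mFourier n (torusMap b x) ∂ν = 0
      simp_rw [mFourier_torusMap]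
      exact h n
    intro φ
    have : φ ∈ LinearMap.ker Φ'.toLinearMap :=
      hker (by rw [UnitAddTorus.span_mFourier_closure_eq_top]; trivial)
    exact this
  have hborel : ∀ B : Set (UnitAddTorus ι), MeasurableSet B →
      ∫ x in torusMap b ⁻¹' B, F x ∂ν = 0 := by
    intro B hB
    have hBm : MeasurableSet (torusMap b ⁻¹' B) := hπ.measurable hB
    -- approximate the indicator of `B` in the norm of `L¹` of the pushforward of `|F|`
    let κ : Measure (Space d) := ν.withDensity fun x => ‖F x‖ₑ
    have hκfin : IsFiniteMeasure κ := isFiniteMeasure_withDensity hF.2.ne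
    let μ : Measure (UnitAddTorus ι) := κ.map (torusMap b)
    have hμfin : IsFiniteMeasure μ := Measure.isFiniteMeasure_map _ _
    have hind : Integrable (B.indicator fun _ => (1 : ℂ)) μ :=
      (integrable_const _).indicator hB
    have key : ∀ ε > 0, ‖∫ x in torusMap b ⁻¹' B, F x ∂ν‖ ≤ ε := by
      intro ε hε
      obtain ⟨φ, hφ, hφi⟩ := hind.exists_boundedContinuous_integral_sub_le hε
      have h0 := hcont φ.toContinuousMap
      have h1 : ∫ x in torusMap b ⁻¹' B, F x ∂ν
          = ∫ x, F x * (B.indicator (fun _ => (1 : ℂ)) (torusMap b x) - φ (torusMap b x)) ∂ν := by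
        have hi1 : Integrable (fun x => F x * B.indicator (fun _ => (1 : ℂ)) (torusMap b x)) ν := by
          refine (hF.indicator hBm).congr (Eventually.of_forall fun x => ?_)
          by_cases hx : torusMap b x ∈ B <;> simp [Set.indicator, hx]
        simp_rw [mul_sub]
        have hi2 : Integrable (fun x => F x * φ (torusMap b x)) ν := hmul φ.toContinuousMap
        rw [integral_sub hi1 hi2, ← integral_indicator hBm,
          show ∫ x, F x * φ (torusMap b x) ∂ν = 0 from h0, sub_zero]
        congr 1; ext x
        by_cases hx : torusMap b x ∈ B <;> simp [Set.indicator, hx]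
      rw [h1]
      refine (norm_integral_le_integral_norm _).trans ?_
      have h2 : ∫ y, ‖B.indicator (fun _ => (1 : ℂ)) y - φ y‖ ∂μ
          = ∫ x, ‖F x * (B.indicator (fun _ => (1 : ℂ)) (torusMap b x) - φ (torusMap b x))‖ ∂ν := by
        have hm : AEStronglyMeasurable (fun y => ‖B.indicator (fun _ => (1 : ℂ)) y - φ y‖)
          (κ.map (torusMap b)) := (hind.sub hφi).norm.aestronglyMeasurable
        rw [integral_map hπ.aemeasurable hm]
        rw [integral_withDensity_eq_integral_toReal_smul₀ hF.1.enorm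
          (Eventually.of_forall fun x => enorm_lt_top)]
        simp [hν]
      rw [← h2]; exact hφ
    exact norm_le_zero_iff.1 (le_of_forall_pos_le_add fun ε hε => by simpa using key ε hε)
  refine Integrable.ae_eq_zero_of_forall_setIntegral_eq_zero hF fun s hs _ => ?_
  have hB : MeasurableSet (torusMap b '' (s ∩ D)) :=
    (hs.inter hDm).image_of_continuousOn_injOn hπ.continuousOn
      ((injOn_torusMap b).mono Set.inter_subset_right)
  have h1 := hborel _ hB
  rw [hν, Measure.restrict_restrict (hπ.measurable hB)] at h1
  rw [hν, Measure.restrict_restrict hs, ← h1]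
  congr 2
  ext x
  constructor
  · exact fun hx => ⟨⟨x, hx, rfl⟩, hx.2⟩
  · rintro ⟨⟨y, hy, hyx⟩, hx⟩
    rwa [← injOn_torusMap b hy.2 hx hyx]

end DualLattice

/-! ### Vandermonde estimates -/

section Vandermonde

/-- The lower Riesz bound for a Vandermonde matrix with distinct nodes indexed by a finite set. -/
lemma exists_sum_norm_sq_le_vandermonde {α : Type*} {P : Finset α} {k : ℕ} (hP : P.card = k)
    {w : α → ℂ} (hw : Set.InjOn w P) :
    ∃ K : ℝ, 0 ≤ K ∧ ∀ z : Fin k → ℂ,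
      ∑ j, ‖z j‖ ^ 2 ≤ K * ∑ l ∈ P, ‖∑ j, z j * w l ^ (j : ℕ)‖ ^ 2 := by
  classical
  subst hP
  let e := P.equivFin
  let M : Matrix (Fin P.card) (Fin P.card) ℂ := Matrix.vandermonde fun i => w (e.symm i)
  have hinj : Function.Injective fun i => w (e.symm i) := fun i j hij =>
    e.symm.injective (Subtype.ext (hw (e.symm i).2 (e.symm j).2 hij))
  let f : EuclideanSpace ℂ (Fin P.card) →ₗ[ℂ] EuclideanSpace ℂ (Fin P.card) :=
    Matrix.toEuclideanLin M
  have hf : ∀ z : Fin P.card → ℂ, ∀ i,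
      f (WithLp.toLp 2 z) i = ∑ j, z j * w (e.symm i) ^ (j : ℕ) := fun z i => by
    simp only [f, M, Matrix.toEuclideanLin, Matrix.toLpLin_toLp, Matrix.toLin'_apply,
      Matrix.mulVec, dotProduct, Matrix.vandermonde_apply, mul_comm]
  have hker : LinearMap.ker f = ⊥ := by
    rw [LinearMap.ker_eq_bot']
    intro z hz
    have : z.ofLp = 0 := Matrix.eq_zero_of_forall_index_sum_mul_pow_eq_zero hinj fun i => by
      rw [← hf, WithLp.toLp_ofLp, hz]; rfl
    exact (WithLp.ofLp_eq_zero 2).1 this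
  obtain ⟨K, -, hK⟩ := f.exists_antilipschitzWith hker
  refine ⟨(K : ℝ) ^ 2, by positivity, fun z => ?_⟩
  have h1 := hK.le_mul_dist (WithLp.toLp 2 z) 0
  rw [map_zero, dist_zero_right, dist_zero_right] at h1
  have h2 : ‖WithLp.toLp 2 z‖ ^ 2 ≤ ((K : ℝ) * ‖f (WithLp.toLp 2 z)‖) ^ 2 := by gcongr
  rw [mul_pow, EuclideanSpace.norm_sq_eq, EuclideanSpace.norm_sq_eq] at h2
  refine h2.trans_eq ?_
  congr 1
  simp_rw [hf]
  rw [← Finset.sum_coe_sort P, ← e.symm.sum_comp]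

lemma eq_zero_of_forall_sum_mul_pow_eq_zero {α : Type*} (P : Finset α) {w : α → ℂ}
    (hw : Set.InjOn w P) {v : α → ℂ}
    (h : ∀ j < P.card, ∑ l ∈ P, v l * w l ^ j = 0) : ∀ l ∈ P, v l = 0 := by
  let e := P.equivFin
  have hinj : Function.Injective fun i => w (e.symm i) := fun i j hij =>
    e.symm.injective (Subtype.ext (hw (e.symm i).2 (e.symm j).2 hij))
  have h0 : (fun i => v (e.symm i)) = 0 :=
    Matrix.eq_zero_of_forall_pow_sum_mul_pow_eq_zero hinj fun j => by
      rw [e.symm.sum_comp (fun l : P => v l * w l ^ (j : ℕ)),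
        Finset.sum_coe_sort P (fun l => v l * w l ^ (j : ℕ))]
      exact h j j.2
  intro l hl
  simpa using congrFun h0 (e ⟨l, hl⟩)

lemma norm_sum_mul_pow_sq_le {k : ℕ} (z : Fin k → ℂ) {w : ℂ} (hw : ‖w‖ = 1) :
    ‖∑ j, z j * w ^ (j : ℕ)‖ ^ 2 ≤ k * ∑ j, ‖z j‖ ^ 2 := by
  have h1 : ‖∑ j, z j * w ^ (j : ℕ)‖ ≤ ∑ j, ‖z j‖ :=
    (norm_sum_le _ _).trans_eq (by simp [hw])
  calc _ ≤ (∑ j, ‖z j‖) ^ 2 := by gcongr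
    _ ≤ _ := by simpa using sq_sum_le_card_mul_sum_sq (s := Finset.univ) (f := fun j => ‖z j‖)

end Vandermonde

/-! ### Folding into a fundamental domain -/

section Folding

open Module

variable {d : ℕ} {ι : Type*} (b : Basis ι ℝ (Space d))

lemma integrable_indicator_vadd {E : Type*} [NormedAddCommGroup E] {S : Set (Space d)}
    (hSm : MeasurableSet S) {g : Space d → E} (hg : IntegrableOn g S)
    (l : Submodule.span ℤ (Set.range b)) :
    Integrable (fun x => S.indicator g (l +ᵥ x)) := by
  have := (integrable_indicator_iff hSm).2 hg
  exact this.comp_add_left (l : Space d)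

variable [Fintype ι]

open scoped Pointwise in
lemma exists_finset_forall_vadd_notMem {S : Set (Space d)} (hS : Bornology.IsBounded S) :
    ∃ N : Finset (Submodule.span ℤ (Set.range b)), ∀ l ∉ N,
      ∀ x ∈ ZSpan.fundamentalDomain b, l +ᵥ x ∉ S := by
  classical
  have hbd : Bornology.IsBounded (S - ZSpan.fundamentalDomain b) :=
    Bornology.IsBounded.sub hS (ZSpan.fundamentalDomain_isBounded b)
  have hfin := ZSpan.setFinite_inter b hbd
  have hfin' : {l : Submodule.span ℤ (Set.range b) |
      (l : Space d) ∈ S - ZSpan.fundamentalDomain b}.Finite := by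
    refine (hfin.preimage Subtype.val_injective.injOn).subset fun l hl => ⟨hl, l.2⟩
  refine ⟨hfin'.toFinset, fun l hl x hx hxS => hl ?_⟩
  rw [Set.Finite.mem_toFinset]
  exact ⟨_, hxS, x, hx, by simp [Submodule.vadd_def]⟩

/-- Folding an integral over `S` into the fundamental domain. -/
lemma setIntegral_eq_setIntegral_sum_vadd {E : Type*} [NormedAddCommGroup E] [NormedSpace ℝ E]
    {S : Set (Space d)} (hSm : MeasurableSet S) {N : Finset (Submodule.span ℤ (Set.range b))}
    (hN : ∀ l ∉ N, ∀ x ∈ ZSpan.fundamentalDomain b, l +ᵥ x ∉ S)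
    {g : Space d → E} (hg : IntegrableOn g S) :
    ∫ x in S, g x = ∫ x in ZSpan.fundamentalDomain b, ∑ l ∈ N, S.indicator g (l +ᵥ x) := by
  have hD := ZSpan.isAddFundamentalDomain b (volume : Measure (Space d))
  rw [← integral_indicator hSm,
    hD.integral_eq_tsum'' _ ((integrable_indicator_iff hSm).2 hg),
    integral_finsetSum _ fun l _ => (integrable_indicator_vadd b hSm hg l).integrableOn]
  refine tsum_eq_sum fun l hl => ?_
  refine setIntegral_eq_zero_of_forall_eq_zero fun x hx => ?_
  exact Set.indicator_of_notMem (hN l hl x hx) _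

end Folding

/-! ### Riesz bounds and completeness on a multi-tile -/

section RieszBounds

open Module

variable {d : ℕ} {ι : Type*} (b : Basis ι ℝ (Space d))

lemma integrableOn_of_continuous_of_isBounded {E : Type*} [NormedAddCommGroup E]
    {S : Set (Space d)} (hSb : Bornology.IsBounded S) {g : Space d → E} (hg : Continuous g) :
    IntegrableOn g S := by
  have hc : IsCompact (closure S) := hSb.isCompact_closure
  exact (hg.continuousOn.integrableOn_compact hc).mono_set subset_closure

open Classical in
lemma sum_indicator_vadd {E : Type*} [AddCommMonoid E] (S : Set (Space d))
    (N : Finset (Submodule.span ℤ (Set.range b))) (g : Space d → E) (x : Space d) :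
    ∑ l ∈ N, S.indicator g (l +ᵥ x) = ∑ l ∈ N with l +ᵥ x ∈ S, g (l +ᵥ x) := by
  rw [Finset.sum_filter]
  rfl

open Classical in
lemma card_filter_vadd_mem {S : Set (Space d)} {N : Finset (Submodule.span ℤ (Set.range b))}
    (hN : ∀ l ∉ N, ∀ x ∈ ZSpan.fundamentalDomain b, l +ᵥ x ∉ S) {x : Space d}
    (hx : x ∈ ZSpan.fundamentalDomain b) :
    (N.filter fun l => l +ᵥ x ∈ S).card
      = {l : Submodule.span ℤ (Set.range b) | l +ᵥ x ∈ S}.ncard := by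
  rw [← Set.ncard_coe_finset]
  congr 1
  ext l
  simp only [Finset.coe_filter, Set.mem_ofPred_eq, and_iff_right_iff_imp]
  exact fun hl => by_contra fun h => hN l h x hx hl

variable [Fintype ι]

/-- Two-sided Riesz bounds on a multi-tile. After folding into the fundamental domain, the
combination at `l +ᵥ x` is a polynomial expression in the node `expFun a l` whose coefficients have
the moduli of `k` lattice-periodic trigonometric polynomials at `x`; the `k` nodes attached to `x`
are distinct and range over finitely many sets. -/
lemma exists_riesz_bounds {S : Set (Space d)} (hSm : MeasurableSet S)
    (hSb : Bornology.IsBounded S) {k : ℕ}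
    (hk : ∀ᵐ x : Space d, {l : Submodule.span ℤ (Set.range b) | l +ᵥ x ∈ S}.ncard = k)
    {a : Space d} (ha : Set.InjOn (expFun a) (Submodule.span ℤ (Set.range b))) :
    ∃ A B : ℝ, 0 ≤ A ∧ 0 ≤ B ∧ ∀ (t : Finset (ι → ℤ)) (c : (ι → ℤ) → Fin k → ℂ),
      (∑ n ∈ t, ∑ j, ‖c n j‖ ^ 2 ≤
        A * ∫ x in S, ‖∑ n ∈ t, ∑ j, c n j * expFun (dualVec b n + (j : ℕ) • a) x‖ ^ 2) ∧
      (∫ x in S, ‖∑ n ∈ t, ∑ j, c n j * expFun (dualVec b n + (j : ℕ) • a) x‖ ^ 2 ≤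
        B * ∑ n ∈ t, ∑ j, ‖c n j‖ ^ 2) := by
  classical
  obtain ⟨N, hN⟩ := exists_finset_forall_vadd_notMem b hSb
  set D := ZSpan.fundamentalDomain b with hDdef
  have hDm : MeasurableSet D := ZSpan.fundamentalDomain_measurableSet b
  have hDb : Bornology.IsBounded D := ZSpan.fundamentalDomain_isBounded b
  set V := volume.real D with hVdef
  have hV : 0 < V := by
    refine ENNReal.toReal_pos ?_ (volume_fundamentalDomain_lt_top b).ne
    exact ZSpan.measure_fundamentalDomain_ne_zero b
  let w : Submodule.span ℤ (Set.range b) → ℂ := fun l => expFun a l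
  have hw : Function.Injective w := fun l m h => Subtype.ext (ha l.2 m.2 h)
  have hKex : ∀ P : Finset (Submodule.span ℤ (Set.range b)), ∃ K : ℝ, 0 ≤ K ∧ (P.card = k →
      ∀ z : Fin k → ℂ, ∑ j, ‖z j‖ ^ 2 ≤ K * ∑ l ∈ P, ‖∑ j, z j * w l ^ (j : ℕ)‖ ^ 2) := by
    intro P
    by_cases hP : P.card = k
    · obtain ⟨K, hK, h⟩ := exists_sum_norm_sq_le_vandermonde hP hw.injOn
      exact ⟨K, hK, fun _ => h⟩
    · exact ⟨0, le_rfl, fun h => absurd h hP⟩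
  choose κ hκ0 hκ using hKex
  -- the sum over all subsets of `N` is a lower Riesz constant valid for every pattern of nodes
  set K := ∑ P ∈ N.powerset, κ P with hKdef
  have hK0 : 0 ≤ K := Finset.sum_nonneg fun P _ => hκ0 P
  refine ⟨V⁻¹ * K, k * k * V, by positivity, by positivity, fun t c => ?_⟩
  set v : Space d → ℂ := fun x => ∑ n ∈ t, ∑ j, c n j * expFun (dualVec b n + (j : ℕ) • a) x
    with hv
  have hvc : Continuous v := by
    refine continuous_finsetSum _ fun n _ => continuous_finsetSum _ fun j _ => ?_
    exact continuous_const.mul (continuous_expFun _)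
  let G : Fin k → Space d → ℂ := fun j x => ∑ n ∈ t, c n j * expFun (dualVec b n) x
  have hGc : ∀ j, Continuous (G j) := fun j =>
    continuous_finsetSum _ fun n _ => continuous_const.mul (continuous_expFun _)
  let Q : Space d → ℝ := fun x => ∑ j, ‖G j x‖ ^ 2
  have hQi : IntegrableOn Q D := integrableOn_of_continuous_of_isBounded hDb
    (continuous_finsetSum _ fun j _ => (hGc j).norm.pow 2)
  have hQint : ∫ x in D, Q x = V * ∑ n ∈ t, ∑ j, ‖c n j‖ ^ 2 := by
    have hGi : ∀ j, Integrable (fun x => ‖G j x‖ ^ 2) (volume.restrict D) := fun j =>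
      integrableOn_of_continuous_of_isBounded hDb ((hGc j).norm.pow 2)
    rw [integral_finsetSum _ fun j _ => hGi j]
    simp_rw [G, hDdef, setIntegral_norm_sq_sum_expFun]
    rw [← Finset.mul_sum, Finset.sum_comm]
  let R : Space d → ℝ := fun x => ∑ l ∈ N, S.indicator (fun y => ‖v y‖ ^ 2) (l +ᵥ x)
  have hvi : IntegrableOn (fun y => ‖v y‖ ^ 2) S :=
    integrableOn_of_continuous_of_isBounded hSb (hvc.norm.pow 2)
  have hRi : IntegrableOn R D :=
    integrable_finsetSum _ fun l _ => (integrable_indicator_vadd b hSm hvi l).integrableOn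
  have hRint : ∫ x in S, ‖v x‖ ^ 2 = ∫ x in D, R x :=
    setIntegral_eq_setIntegral_sum_vadd b hSm hN hvi
  have hvl : ∀ (l : Submodule.span ℤ (Set.range b)) x,
      v (l +ᵥ x) = ∑ j, (G j x * expFun a x ^ (j : ℕ)) * w l ^ (j : ℕ) := by
    intro l x
    simp only [hv, G, w, Finset.sum_mul]
    rw [Finset.sum_comm]
    refine Finset.sum_congr rfl fun j _ => Finset.sum_congr rfl fun n _ => ?_
    rw [expFun_add_left, expFun_dualVec_vadd, expFun_nsmul_left, Submodule.vadd_def, vadd_eq_add,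
      expFun_add_right, mul_pow]
    ring
  have hz : ∀ x, ∑ j, ‖G j x * expFun a x ^ (j : ℕ)‖ ^ 2 = Q x := fun x => by
    simp [Q, norm_expFun]
  have hpt : ∀ᵐ x ∂volume.restrict D, Q x ≤ K * R x ∧ R x ≤ (k * k) * Q x := by
    filter_upwards [ae_restrict_of_ae hk, ae_restrict_mem hDm] with x hx hxD
    set P := N.filter fun l => l +ᵥ x ∈ S with hPdef
    have hP : P.card = k := (card_filter_vadd_mem b hN hxD).trans hx
    have hR : R x = ∑ l ∈ P, ‖∑ j, (G j x * expFun a x ^ (j : ℕ)) * w l ^ (j : ℕ)‖ ^ 2 := by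
      simp only [R]
      rw [sum_indicator_vadd]
      simp_rw [hvl]
      rfl
    rw [hR]
    constructor
    · have h1 := hκ P hP fun j => G j x * expFun a x ^ (j : ℕ)
      rw [hz] at h1
      refine h1.trans ?_
      gcongr
      exact Finset.single_le_sum (f := κ) (fun P _ => hκ0 P)
        (Finset.mem_powerset.2 (Finset.filter_subset _ _))
    · calc _ ≤ ∑ l ∈ P, (k : ℝ) * Q x := by
            refine Finset.sum_le_sum fun l _ => ?_
            rw [← hz]
            exact norm_sum_mul_pow_sq_le _ (norm_expFun _ _)
        _ = _ := by rw [Finset.sum_const, hP, nsmul_eq_mul]; ring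
  constructor
  · have h1 : ∫ x in D, Q x ≤ ∫ x in D, K * R x :=
      integral_mono_ae hQi (hRi.const_mul K) (hpt.mono fun x hx => hx.1)
    rw [integral_const_mul, hQint, ← hRint] at h1
    rw [mul_assoc, le_inv_mul_iff₀ hV]
    exact h1
  · have h1 : ∫ x in D, R x ≤ ∫ x in D, (k * k) * Q x :=
      integral_mono_ae hRi (hQi.const_mul _) (hpt.mono fun x hx => hx.2)
    rw [integral_const_mul, hQint, ← hRint] at h1
    rw [mul_assoc ((k : ℝ) * k)]
    exact h1

/-- Completeness on a multi-tile: an integrable function on `S` orthogonal to all the exponentials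
vanishes almost everywhere. Folding shows that its `k` twisted periodizations vanish, and the
values on each lattice coset are recovered from these through a Vandermonde system. -/
lemma ae_eq_zero_of_forall_setIntegral_mul_conj_expFun {S : Set (Space d)}
    (hSm : MeasurableSet S) (hSb : Bornology.IsBounded S) {k : ℕ}
    (hk : ∀ᵐ x : Space d, {l : Submodule.span ℤ (Set.range b) | l +ᵥ x ∈ S}.ncard = k)
    {a : Space d} (ha : Set.InjOn (expFun a) (Submodule.span ℤ (Set.range b)))
    {f : Space d → ℂ} (hf : IntegrableOn f S)
    (h : ∀ (n : ι → ℤ) (j : Fin k),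
      ∫ x in S, f x * (starRingEnd ℂ) (expFun (dualVec b n + (j : ℕ) • a) x) = 0) :
    ∀ᵐ x ∂volume.restrict S, f x = 0 := by
  classical
  obtain ⟨N, hN⟩ := exists_finset_forall_vadd_notMem b hSb
  set D := ZSpan.fundamentalDomain b with hDdef
  have hDm : MeasurableSet D := ZSpan.fundamentalDomain_measurableSet b
  have hfi : ∀ l, IntegrableOn (fun x => f x * (starRingEnd ℂ) (expFun l x)) S := fun l =>
    hf.mul_bdd (c := 1) (Complex.continuous_conj.comp (continuous_expFun l)).aestronglyMeasurable
      (Eventually.of_forall fun x => by rw [RCLike.norm_conj, norm_expFun])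
  let F : Fin k → Space d → ℂ := fun j x =>
    ∑ l ∈ N, S.indicator (fun y => f y * (starRingEnd ℂ) (expFun ((j : ℕ) • a) y)) (l +ᵥ x)
  have hFi : ∀ j, IntegrableOn (F j) D := fun j =>
    integrable_finsetSum _ fun l _ => (integrable_indicator_vadd b hSm (hfi _) l).integrableOn
  have hF0 : ∀ j, ∀ᵐ x ∂volume.restrict D, F j x = 0 := by
    intro j
    refine ae_eq_zero_of_forall_setIntegral_mul_expFun b (hFi j) fun n => ?_
    rw [← h (-n) j, setIntegral_eq_setIntegral_sum_vadd b hSm hN (hfi _)]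
    congr 1
    ext x
    simp only [F, Finset.sum_mul]
    refine Finset.sum_congr rfl fun l _ => ?_
    by_cases hx : l +ᵥ x ∈ S
    · rw [Set.indicator_of_mem hx, Set.indicator_of_mem hx, expFun_add_left, map_mul,
        ← expFun_neg_left (dualVec b (-n)), show -dualVec b (-n) = dualVec b n by
          rw [← zero_sub (dualVec b (-n)), ← dualVec_zero b, ← dualVec_sub]; simp,
        expFun_dualVec_vadd]
      ring
    · rw [Set.indicator_of_notMem hx, Set.indicator_of_notMem hx, zero_mul]
  have hint : ∫ x in S, ‖f x‖ = 0 := by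
    rw [setIntegral_eq_setIntegral_sum_vadd b hSm hN hf.norm]
    refine integral_eq_zero_of_ae ?_
    filter_upwards [ae_all_iff.2 hF0, ae_restrict_of_ae hk, ae_restrict_mem hDm] with x hx hxk hxD
    rw [sum_indicator_vadd]
    set P := N.filter fun l => l +ᵥ x ∈ S with hPdef
    have hP : P.card = k := (card_filter_vadd_mem b hN hxD).trans hxk
    refine Finset.sum_eq_zero fun l hl => norm_eq_zero.2 ?_
    refine eq_zero_of_forall_sum_mul_pow_eq_zero P
      (w := fun l => (starRingEnd ℂ) (expFun a (l +ᵥ x))) (v := fun l => f (l +ᵥ x)) ?_ ?_ l hl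
    · intro l _ m _ hlm
      have h1 := (starRingEnd ℂ).injective hlm
      rw [Submodule.vadd_def, Submodule.vadd_def, vadd_eq_add, vadd_eq_add, expFun_add_right,
        expFun_add_right] at h1
      have h2 : expFun a x ≠ 0 := by
        rw [← norm_ne_zero_iff, norm_expFun]; norm_num
      exact Subtype.ext (ha l.2 m.2 (mul_right_cancel₀ h2 h1))
    · intro j hj
      have := hx ⟨j, hP ▸ hj⟩
      simp only [F] at this
      rw [sum_indicator_vadd] at this
      rw [← this]
      refine Finset.sum_congr rfl fun l _ => ?_
      rw [expFun_nsmul_left, map_pow]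
  have := (integral_eq_zero_iff_of_nonneg_ae (Eventually.of_forall fun x => norm_nonneg _)
    hf.norm).1 hint
  exact this.mono fun x hx => norm_eq_zero.1 hx

end RieszBounds

/-! ### Riesz bases of exponentials on multi-tiles -/

section MultiTile

open Module BoundedContinuousFunction

variable {d : ℕ}

/-- The exponential `e_l` as a bounded continuous function. -/
noncomputable def expBCF (l : Space d) : Space d →ᵇ ℂ :=
  BoundedContinuousFunction.ofNormedAddCommGroup (expFun l) (continuous_expFun l) 1
    fun x => (norm_expFun l x).le

lemma norm_sq_toLp_eq_setIntegral {S : Set (Space d)} [IsFiniteMeasure (volume.restrict S)]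
    (g : Space d →ᵇ ℂ) :
    ‖BoundedContinuousFunction.toLp 2 (volume.restrict S) ℂ g‖ ^ 2 = ∫ x in S, ‖g x‖ ^ 2 := by
  have h1 := @inner_self_eq_norm_sq_to_K ℂ _ _ _ _
    (BoundedContinuousFunction.toLp 2 (volume.restrict S) ℂ g)
  rw [L2.inner_def] at h1
  have h2 : ∫ x in S, inner ℂ ((BoundedContinuousFunction.toLp 2 (volume.restrict S) ℂ g :
      Lp ℂ 2 (volume.restrict S)) x) ((BoundedContinuousFunction.toLp 2 (volume.restrict S) ℂ g :
      Lp ℂ 2 (volume.restrict S)) x) = ∫ x in S, ((‖g x‖ ^ 2 : ℝ) : ℂ) := by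
    refine integral_congr_ae ?_
    filter_upwards [BoundedContinuousFunction.coeFn_toLp 2 (volume.restrict S) ℂ g] with x hx
    rw [hx, inner_self_eq_norm_sq_to_K]
    norm_cast
  rw [h2, integral_complex_ofReal] at h1
  exact (Complex.ofReal_injective (by simpa using h1)).symm

/-- A bounded measurable set whose translates by a lattice cover almost every point the same number
of times has a Riesz basis of exponentials: the frequencies are `k` translates of the dual lattice
by multiples of a generic vector `a`. -/
theorem exists_isRieszBasisOfExponentials_of_multitile (L : Submodule ℤ (Space d))
    [DiscreteTopology L] [IsZLattice ℝ L] {S : Set (Space d)} (hSm : MeasurableSet S)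
    (hSb : Bornology.IsBounded S) {k : ℕ}
    (hk : ∀ᵐ x : Space d, {l : L | l +ᵥ x ∈ S}.ncard = k) :
    ∃ Γ : Set (Space d), IsRieszBasisOfExponentials S Γ := by
  classical
  have : Module.Free ℤ L := ZLattice.module_free ℝ L
  have : Module.Finite ℤ L := ZLattice.module_finite ℝ L
  let b := (Module.Free.chooseBasis ℤ L).ofZLatticeBasis ℝ L
  have hb : Submodule.span ℤ (Set.range b) = L :=
    (Module.Free.chooseBasis ℤ L).ofZLatticeBasis_span ℝ L
  have hkb : ∀ᵐ x : Space d, {l : Submodule.span ℤ (Set.range b) | l +ᵥ x ∈ S}.ncard = k := by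
    rw [hb]; exact hk
  have hcount : (Submodule.span ℤ (Set.range b) : Set (Space d)).Countable :=
    Set.countable_coe_iff.1 (inferInstanceAs (Countable (Submodule.span ℤ (Set.range b))))
  obtain ⟨a, ha⟩ := exists_expFun_injOn hcount
  obtain ⟨A, B, -, hB, hbounds⟩ := exists_riesz_bounds b hSm hSb hkb ha
  have hfin : IsFiniteMeasure (volume.restrict S) :=
    ⟨by rw [Measure.restrict_apply_univ]; exact hSb.measure_lt_top⟩
  let freq : (Module.Free.ChooseBasisIndex ℤ L → ℤ) × Fin k → Space d :=
    fun p => dualVec b p.1 + (p.2 : ℕ) • a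
  let v : Space d → Lp ℂ 2 (volume.restrict S) := fun l =>
    BoundedContinuousFunction.toLp 2 (volume.restrict S) ℂ (expBCF l)
  have hv : ∀ l, v l =ᵐ[volume.restrict S] expFun l := fun l =>
    BoundedContinuousFunction.coeFn_toLp 2 (volume.restrict S) ℂ (expBCF l)
  have hsum : ∀ (s : Finset ((Module.Free.ChooseBasisIndex ℤ L → ℤ) × Fin k)) (c : _ → ℂ),
      ∑ p ∈ s, ‖c p‖ ^ 2 ≤ A * ‖∑ p ∈ s, c p • v (freq p)‖ ^ 2 ∧
      ‖∑ p ∈ s, c p • v (freq p)‖ ^ 2 ≤ B * ∑ p ∈ s, ‖c p‖ ^ 2 := by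
    intro s c
    -- extend the coefficients by zero to a product of index sets
    let c' : (Module.Free.ChooseBasisIndex ℤ L → ℤ) → Fin k → ℂ :=
      fun n j => if (n, j) ∈ s then c (n, j) else 0
    have hext : ∀ {E : Type} [AddCommMonoid E] (g : _ → E),
        ∑ n ∈ s.image Prod.fst, ∑ j, (if (n, j) ∈ s then g (n, j) else 0) = ∑ p ∈ s, g p := by
      intro E _ g
      rw [← Finset.sum_product (s.image Prod.fst) Finset.univ
        fun p => if (p.1, p.2) ∈ s then g (p.1, p.2) else 0]
      simp only [Prod.mk.eta]
      rw [← Finset.sum_filter]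
      refine Finset.sum_congr ?_ fun _ _ => rfl
      ext p
      simp only [Finset.mem_filter, Finset.mem_product, Finset.mem_univ, and_true,
        and_iff_right_iff_imp]
      exact fun hp => Finset.mem_image_of_mem _ hp
    have h1 : ∑ n ∈ s.image Prod.fst, ∑ j, ‖c' n j‖ ^ 2 = ∑ p ∈ s, ‖c p‖ ^ 2 := by
      rw [← hext]
      refine Finset.sum_congr rfl fun n _ => Finset.sum_congr rfl fun j _ => ?_
      by_cases h : (n, j) ∈ s <;> simp [c', h]
    have h2 : ∫ x in S, ‖∑ n ∈ s.image Prod.fst, ∑ j,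
        c' n j * expFun (dualVec b n + (j : ℕ) • a) x‖ ^ 2
        = ‖∑ p ∈ s, c p • v (freq p)‖ ^ 2 := by
      have : ∑ p ∈ s, c p • v (freq p) = BoundedContinuousFunction.toLp 2 (volume.restrict S) ℂ
          (∑ p ∈ s, c p • expBCF (freq p)) := by
        simp only [map_sum, map_smul, v]
      rw [this, norm_sq_toLp_eq_setIntegral]
      congr 1
      ext x
      congr 2
      rw [BoundedContinuousFunction.sum_apply, ← hext]
      refine Finset.sum_congr rfl fun n _ => Finset.sum_congr rfl fun j _ => ?_
      by_cases h : (n, j) ∈ s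
      · simp only [c', h, if_true]; rfl
      · simp only [c', h, if_false, zero_mul]
    have := hbounds (s.image Prod.fst) c'
    rwa [h1, h2] at this
  have hinj : Function.Injective freq := by
    intro p q hpq
    by_contra hne
    -- equal frequencies would make the difference of two basis vectors a null combination
    have h1 := (hsum {p, q} fun r => if r = p then 1 else -1).1
    rw [Finset.sum_pair hne, Finset.sum_pair hne, hpq] at h1
    simp only [if_true, Ne.symm hne, if_false, one_smul, neg_smul, add_neg_cancel, norm_zero,
      norm_one, norm_neg] at h1
    norm_num at h1
  let e := Equiv.ofInjective freq hinj
  have hmap : ∀ {E : Type} [AddCommMonoid E] (s : Finset (Set.range freq))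
      (g : Set.range freq → E), ∑ i ∈ s.map e.symm.toEmbedding, g (e i) = ∑ i ∈ s, g i := by
    intro E _ s g
    simp
  have hγ : ∀ p, ((e p : Set.range freq) : Space d) = freq p := fun p => rfl
  refine ⟨Set.range freq, ?_⟩
  obtain ⟨T, hT⟩ := exists_analysisEquiv (v := fun γ : Set.range freq => v γ) (A := A) hB
    (fun s c => by
      have := (hsum (s.map e.symm.toEmbedding) fun p => c (e p)).1
      rw [hmap s fun i => ‖c i‖ ^ 2] at this
      simp_rw [← hγ] at this
      rwa [hmap s fun i => c i • v i] at this)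
    (fun s c => by
      have := (hsum (s.map e.symm.toEmbedding) fun p => c (e p)).2
      rw [hmap s fun i => ‖c i‖ ^ 2] at this
      simp_rw [← hγ] at this
      rwa [hmap s fun i => c i • v i] at this)
    (by
      intro f hf
      have hfi : IntegrableOn f S := (Lp.memLp f).integrable (by norm_num)
      have h0 := ae_eq_zero_of_forall_setIntegral_mul_conj_expFun b hSm hSb hkb ha hfi
        fun n j => by
          rw [← hf ⟨freq (n, j), (n, j), rfl⟩, L2.inner_def]
          refine integral_congr_ae ?_
          filter_upwards [hv (freq (n, j))] with x hx
          rw [hx]; rfl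
      exact (Lp.eq_zero_iff_ae_eq_zero).2 h0)
  refine ⟨T, fun f l => ?_⟩
  rw [hT, L2.inner_def]
  refine integral_congr_ae ?_
  filter_upwards [hv l] with x hx
  rw [hx]; rfl

end MultiTile

/-! ### The flat part of the boundary -/

section FlatBoundary

variable {d : ℕ} {S : Set (Space d)}

/-- `n` is an outer normal of `S` at the flat boundary point `x`. -/
def IsFlatNormal (S : Set (Space d)) (x n : Space d) : Prop :=
  n ≠ 0 ∧ ∀ᶠ y in 𝓝 x, (y ∈ S ↔ inner ℝ n (y - x) ≤ (0 : ℝ))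

/-- The directions that point into `S` at `x`. At a flat boundary point this is a closed half-space,
and it serves as a canonical substitute for the choice of an outer normal. -/
def inwardDirections (S : Set (Space d)) (x : Space d) : Set (Space d) :=
  {z | ∀ᶠ s : ℝ in 𝓝[>] 0, x + s • z ∈ S}

lemma tendsto_add_smul_nhdsGT (x z : Space d) :
    Tendsto (fun s : ℝ => x + s • z) (𝓝[>] 0) (𝓝 x) := by
  have : Tendsto (fun s : ℝ => x + s • z) (𝓝 0) (𝓝 (x + (0 : ℝ) • z)) :=
    (by fun_prop : Continuous fun s : ℝ => x + s • z).tendsto 0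
  simpa using this.mono_left nhdsWithin_le_nhds

lemma IsFlatNormal.mem_inwardDirections_iff {x n : Space d} (h : IsFlatNormal S x n)
    (z : Space d) : z ∈ inwardDirections S x ↔ inner ℝ n z ≤ (0 : ℝ) := by
  have h1 : ∀ᶠ s : ℝ in 𝓝[>] 0, (x + s • z ∈ S ↔ inner ℝ n z ≤ (0 : ℝ)) := by
    filter_upwards [(tendsto_add_smul_nhdsGT x z).eventually h.2, self_mem_nhdsWithin] with s hs hs0
    rw [hs, add_sub_cancel_left, inner_smul_right]
    exact ⟨fun h => nonpos_of_mul_nonpos_right h hs0, fun h => mul_nonpos_of_nonneg_of_nonpos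
      (le_of_lt hs0) h⟩
  constructor
  · intro hz
    obtain ⟨s, hs, hs'⟩ := (h1.and hz).exists
    exact hs.1 hs'
  · intro hz
    exact h1.mono fun s hs => hs.2 hz

lemma IsFlatNormal.mem {x n : Space d} (h : IsFlatNormal S x n) : x ∈ S := by
  rw [h.2.self_of_nhds]; simp

lemma IsFlatNormal.notMem_interior {x n : Space d} (h : IsFlatNormal S x n) :
    x ∉ interior S := by
  intro hx
  have h1 : n ∈ inwardDirections S x :=
    (tendsto_add_smul_nhdsGT x n).eventually (mem_interior_iff_mem_nhds.1 hx)
  rw [h.mem_inwardDirections_iff, real_inner_self_eq_norm_sq] at h1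
  have := norm_pos_iff.2 h.1
  nlinarith

/-- A normal at `x` is a normal at all nearby points of the hyperplane through `x`. -/
lemma IsFlatNormal.eventually_isFlatNormal {x n : Space d} (h : IsFlatNormal S x n) :
    ∀ᶠ y in 𝓝 x, inner ℝ n (y - x) = (0 : ℝ) → IsFlatNormal S y n := by
  filter_upwards [h.2.eventually_nhds] with y hy hy0
  refine ⟨h.1, hy.mono fun z hz => ?_⟩
  rw [hz, ← sub_add_sub_cancel z y x, inner_add_right, hy0, add_zero]

lemma IsFlatNormal.eventually_mem_interior_iff {x n : Space d} (h : IsFlatNormal S x n) :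
    ∀ᶠ y in 𝓝 x, (y ∈ interior S ↔ inner ℝ n (y - x) < (0 : ℝ)) := by
  filter_upwards [h.2.eventually_nhds, h.eventually_isFlatNormal] with y hy hy'
  constructor
  · intro hyS
    refine lt_of_le_of_ne ((hy.self_of_nhds).1 (interior_subset hyS)) fun h0 => ?_
    exact (hy' h0).notMem_interior hyS
  · intro hlt
    rw [mem_interior_iff_mem_nhds]
    have hc : ContinuousAt (fun z : Space d => (inner ℝ n (z - x) : ℝ)) y := by fun_prop
    filter_upwards [hy, hc.eventually (gt_mem_nhds hlt)] with z hz hz'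
    exact hz.2 hz'.le

lemma flatBoundary_subset : flatBoundary S ⊆ S := fun _ ⟨_, h⟩ => IsFlatNormal.mem h

lemma flatBoundary_subset_frontier : flatBoundary S ⊆ frontier S := fun _ ⟨_, h⟩ =>
  ⟨subset_closure (IsFlatNormal.mem h), IsFlatNormal.notMem_interior h⟩

/-- Near a flat boundary point all flat boundary points have the same outer normals. -/
lemma IsFlatNormal.eventually_of_mem {x n : Space d} (h : IsFlatNormal S x n) :
    ∀ᶠ y in 𝓝 x, y ∈ flatBoundary S → IsFlatNormal S y n := by
  filter_upwards [h.2, h.eventually_isFlatNormal, h.eventually_mem_interior_iff] with y h1 h2 h3 hy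
  obtain ⟨m, hm⟩ := hy
  refine h2 (le_antisymm (h1.1 (IsFlatNormal.mem hm)) (not_lt.1 fun hlt => ?_))
  exact IsFlatNormal.notMem_interior hm (h3.2 hlt)

lemma inwardDirections_eq_of_mem_connectedComponentIn {x y : Space d}
    (hy : y ∈ connectedComponentIn (flatBoundary S) x) :
    inwardDirections S y = inwardDirections S x := by
  have hx : x ∈ flatBoundary S := connectedComponentIn_nonempty_iff.1 ⟨y, hy⟩
  refine isPreconnected_connectedComponentIn.induction₂
    (fun a b => inwardDirections S a = inwardDirections S b) ?_
    (fun _ _ _ _ _ _ h1 h2 => h1.trans h2) (fun _ _ _ _ h1 => h1.symm) hy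
    (mem_connectedComponentIn hx)
  intro a ha
  obtain ⟨n, hn⟩ := connectedComponentIn_subset _ _ ha
  filter_upwards [(IsFlatNormal.eventually_of_mem hn).filter_mono nhdsWithin_le_nhds,
    self_mem_nhdsWithin] with c hc hc'
  ext z
  rw [(hc (connectedComponentIn_subset _ _ hc')).mem_inwardDirections_iff,
    IsFlatNormal.mem_inwardDirections_iff hn]

/-- The components of a set `G` are relatively closed in `G`. -/
lemma mem_connectedComponentIn_of_mem_closure {X : Type*} [TopologicalSpace X] {G : Set X} {x y : X}
    (hy : y ∈ closure (connectedComponentIn G x)) (hyG : y ∈ G) :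
    y ∈ connectedComponentIn G x := by
  have hx : x ∈ G := by
    by_contra h
    rw [connectedComponentIn_eq_empty h, closure_empty] at hy
    exact hy
  have h1 : IsPreconnected (insert y (connectedComponentIn G x)) :=
    isPreconnected_connectedComponentIn.subset_closure (Set.subset_insert _ _)
      (Set.insert_subset hy subset_closure)
  exact h1.subset_connectedComponentIn (Set.mem_insert_of_mem _ (mem_connectedComponentIn hx))
    (Set.insert_subset hyG (connectedComponentIn_subset _ _)) (Set.mem_insert _ _)

end FlatBoundary

/-! ### Central symmetry -/

section Reflection

variable {d : ℕ} {S : Set (Space d)} {m : Space d}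

lemma sub_mem_iff_of_forall_sub_mem (hm : ∀ x ∈ S, m - x ∈ S) (x : Space d) :
    m - x ∈ S ↔ x ∈ S :=
  ⟨fun h => by simpa using hm _ h, hm x⟩

lemma IsCentrallySymmetric.exists_forall_sub_mem (h : IsCentrallySymmetric S) :
    ∃ m : Space d, ∀ x ∈ S, m - x ∈ S := by
  obtain ⟨c, hc⟩ := h
  refine ⟨c + c, fun x hx => ?_⟩
  have := hc x hx
  rw [Equiv.pointReflection_apply, vsub_eq_sub, vadd_eq_add] at this
  rwa [show c + c - x = c - x + c by abel]

lemma sub_mem_flatBoundary (hm : ∀ x ∈ S, m - x ∈ S) {x : Space d} (hx : x ∈ flatBoundary S) :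
    m - x ∈ flatBoundary S := by
  obtain ⟨n, hn0, hn⟩ := hx
  refine ⟨-n, neg_ne_zero.2 hn0, ?_⟩
  have ht : Tendsto (fun y => m - y) (𝓝 (m - x)) (𝓝 x) := by
    have := (by fun_prop : Continuous fun y : Space d => m - y).tendsto (m - x)
    rwa [sub_sub_cancel] at this
  filter_upwards [ht.eventually hn] with y hy
  rw [sub_mem_iff_of_forall_sub_mem hm] at hy
  rw [hy, inner_neg_left, ← inner_neg_right, show -(y - (m - x)) = m - y - x by abel]

lemma mem_inwardDirections_sub_iff (hm : ∀ x ∈ S, m - x ∈ S) {x z : Space d} :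
    z ∈ inwardDirections S (m - x) ↔ -z ∈ inwardDirections S x := by
  change (∀ᶠ s : ℝ in 𝓝[>] 0, m - x + s • z ∈ S) ↔ ∀ᶠ s : ℝ in 𝓝[>] 0, x + s • -z ∈ S
  refine eventually_congr (Eventually.of_forall fun s => ?_)
  rw [← sub_mem_iff_of_forall_sub_mem hm, show m - (m - x + s • z) = x + s • -z by
    rw [smul_neg]; abel]

lemma image_sub_flatBoundary (hm : ∀ x ∈ S, m - x ∈ S) :
    (fun x => m - x) '' flatBoundary S = flatBoundary S := by
  ext x
  constructor
  · rintro ⟨y, hy, rfl⟩; exact sub_mem_flatBoundary hm hy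
  · exact fun hx => ⟨m - x, sub_mem_flatBoundary hm hx, sub_sub_cancel m x⟩

lemma image_sub_connectedComponentIn (hm : ∀ x ∈ S, m - x ∈ S) {x : Space d}
    (hx : x ∈ flatBoundary S) :
    (fun x => m - x) '' connectedComponentIn (flatBoundary S) x
      = connectedComponentIn (flatBoundary S) (m - x) := by
  have := (Homeomorph.subLeft m).image_connectedComponentIn hx
  simp only [Homeomorph.coe_subLeft, image_sub_flatBoundary hm] at this
  exact this

lemma image_sub_closure (m : Space d) (A : Set (Space d)) :
    (fun x => m - x) '' closure A = closure ((fun x => m - x) '' A) :=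
  (Homeomorph.subLeft m).image_closure A

lemma IsVertex.sub (hm : ∀ x ∈ S, m - x ∈ S) {x : Space d} (hx : IsVertex S x) :
    IsVertex S (m - x) := by
  refine ⟨hm x hx.1, fun u hu => ?_⟩
  have ht : Tendsto (fun p : Space d × ℝ => (m - p.1, -p.2)) (𝓝 (x, 0)) (𝓝 (m - x, 0)) := by
    have := (by fun_prop : Continuous fun p : Space d × ℝ => (m - p.1, -p.2)).tendsto (x, 0)
    simpa using this
  refine hx.2 u ((ht.eventually hu).mono fun p hp => ?_)
  rw [sub_mem_iff_of_forall_sub_mem hm] at hp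
  rw [← hp, ← sub_mem_iff_of_forall_sub_mem hm, show m - (p.1 + p.2 • u) = m - p.1 + -p.2 • u by
    rw [neg_smul]; abel]

lemma sub_mem_extremePoints (hm : ∀ x ∈ S, m - x ∈ S) {x : Space d}
    (hx : x ∈ Set.extremePoints ℝ S) : m - x ∈ Set.extremePoints ℝ S := by
  rw [mem_extremePoints_iff_left] at hx ⊢
  refine ⟨hm x hx.1, fun y hy z hz h => ?_⟩
  have h1 := hx.2 (m - y) (hm y hy) (m - z) (hm z hz) ?_
  · rw [← h1, sub_sub_cancel]
  · obtain ⟨a, b, ha, hb, hab, h⟩ := h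
    refine ⟨a, b, ha, hb, hab, ?_⟩
    rw [smul_sub, smul_sub, ← sub_sub_cancel m x, ← h]
    have : a • m + b • m = m := by rw [← add_smul, hab, one_smul]
    nth_rewrite 3 [← this]
    abel

/-- A nonempty bounded set has at most one center of symmetry: two of them would make the set
invariant under a nonzero translation. -/
lemma eq_of_forall_sub_mem (hSb : Bornology.IsBounded S) (hSn : S.Nonempty) {m' : Space d}
    (hm : ∀ x ∈ S, m - x ∈ S) (hm' : ∀ x ∈ S, m' - x ∈ S) : m = m' := by
  obtain ⟨x, hx⟩ := hSn
  have h1 : ∀ k : ℕ, x + (k : ℝ) • (m - m') ∈ S := by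
    intro k
    induction k with
    | zero => simpa using hx
    | succ k ih =>
      have := hm _ (hm' _ ih)
      convert this using 1
      push_cast
      rw [add_smul, one_smul]; abel
  obtain ⟨C, hC⟩ := hSb.exists_norm_le
  by_contra hne
  have hpos : 0 < ‖m - m'‖ := norm_pos_iff.2 (sub_ne_zero.2 hne)
  obtain ⟨k, hk⟩ := exists_nat_gt ((C + ‖x‖) / ‖m - m'‖)
  rw [div_lt_iff₀ hpos] at hk
  have h2 := norm_sub_norm_le ((k : ℝ) • (m - m')) (-x)
  rw [sub_neg_eq_add, norm_neg, norm_smul, Real.norm_natCast, add_comm _ x] at h2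
  have := hC _ (h1 k)
  linarith

end Reflection

/-! ### Facets and their opposite facets -/

section Facets

variable {d : ℕ} {S : Set (Space d)}

/-- An extreme point of a facet is a vertex: if `S` were locally invariant under translations along
`u` at such a point, then so would be the flat piece of the boundary that accumulates there, and the
point would be the midpoint of a segment in the facet. -/
lemma isVertex_of_mem_extremePoints (hS : IsClosed S) {p v : Space d}
    (hv : v ∈ Set.extremePoints ℝ (closure (connectedComponentIn (flatBoundary S) p))) :
    IsVertex S v := by
  set C := connectedComponentIn (flatBoundary S) p with hC
  have hvF : v ∈ closure C := hv.1
  have hCS : closure C ⊆ S :=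
    closure_minimal ((connectedComponentIn_subset _ _).trans flatBoundary_subset) hS
  refine ⟨hCS hvF, fun u hu => ?_⟩
  rw [nhds_prod_eq] at hu
  obtain ⟨ε, hε, hball⟩ : ∃ ε > 0, ∀ q ∈ Metric.ball v ε, ∀ t : ℝ, |t| < ε →
      (q + t • u ∈ S ↔ q ∈ S) := by
    obtain ⟨pa, ha, pb, hb, hab⟩ := eventually_prod_iff.1 hu
    obtain ⟨ε₁, h1, h1'⟩ := Metric.eventually_nhds_iff.1 ha
    obtain ⟨ε₂, h2, h2'⟩ := Metric.eventually_nhds_iff.1 hb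
    refine ⟨min ε₁ ε₂, lt_min h1 h2, fun q hq t ht => ?_⟩
    refine hab (h1' ?_) (h2' ?_)
    · exact (Metric.mem_ball.1 hq).trans_le (min_le_left _ _)
    · rw [Real.dist_eq, sub_zero]; exact ht.trans_le (min_le_right _ _)
  have hflat : ∀ q ∈ flatBoundary S ∩ Metric.ball v ε, ∀ t : ℝ, |t| < ε →
      q + t • u ∈ flatBoundary S := by
    rintro q ⟨⟨n, hn0, hn⟩, hq⟩ t ht
    refine ⟨n, hn0, ?_⟩
    have hT : Tendsto (fun y => y - t • u) (𝓝 (q + t • u)) (𝓝 q) := by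
      have := (by fun_prop : Continuous fun y : Space d => y - t • u).tendsto (q + t • u)
      rwa [add_sub_cancel_right] at this
    filter_upwards [hT.eventually hn, hT.eventually (Metric.isOpen_ball.mem_nhds hq)] with y hy hy'
    have h1 := hball _ hy' t ht
    rw [sub_add_cancel] at h1
    rw [h1, hy, show y - t • u - q = y - (q + t • u) by abel]
  have hcomp : ∀ q ∈ C ∩ Metric.ball v ε, ∀ t : ℝ, |t| < ε → q + t • u ∈ C := by
    rintro q ⟨hqC, hq⟩ t ht
    have hqG := connectedComponentIn_subset _ _ hqC
    have hpre : IsPreconnected ((fun s : ℝ => q + s • u) '' Metric.ball 0 ε) :=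
      ((convex_ball (0 : ℝ) ε).isPreconnected).image _ (by fun_prop)
    rw [hC, connectedComponentIn_eq hqC]
    refine hpre.subset_connectedComponentIn ⟨0, by simpa using hε, by simp⟩ ?_
      ⟨t, by simpa using ht, rfl⟩
    rintro _ ⟨s, hs, rfl⟩
    exact hflat q ⟨hqG, hq⟩ s (by simpa using hs)
  have hclos : ∀ t : ℝ, |t| < ε → v + t • u ∈ closure C := by
    intro t ht
    have h1 : v ∈ closure (C ∩ Metric.ball v ε) := by
      rw [Set.inter_comm]
      exact Metric.isOpen_ball.inter_closure ⟨Metric.mem_ball_self hε, hvF⟩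
    exact map_mem_closure (f := fun q : Space d => q + t • u) (by fun_prop) h1
      fun q hq => hcomp q hq t ht
  have h2 : |ε / 2| < ε := by rw [abs_of_pos (half_pos hε)]; exact half_lt_self hε
  have h3 := (mem_extremePoints_iff_left.1 hv).2 (v + (ε / 2) • u) (hclos _ h2)
    (v + (-(ε / 2)) • u) (hclos _ (by rwa [abs_neg]))
    ⟨1 / 2, 1 / 2, by norm_num, by norm_num, by norm_num, by module⟩
  have h4 : (ε / 2) • u = 0 := by simpa using h3
  exact (smul_eq_zero.1 h4).resolve_left (half_pos hε).ne'

lemma closure_component_subset_frontier (p : Space d) :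
    closure (connectedComponentIn (flatBoundary S) p) ⊆ frontier S :=
  closure_minimal ((connectedComponentIn_subset _ _).trans flatBoundary_subset_frontier)
    isClosed_frontier

/-- The translation carrying a facet to the opposite one is a difference of two vertices. -/
lemma sub_mem_of_facet (hSc : IsCompact S) {L : Submodule ℤ (Space d)}
    (hL : ∀ x, IsVertex S x → x ∈ L) {m μ p : Space d} (hm : ∀ x ∈ S, m - x ∈ S)
    (hp : p ∈ flatBoundary S)
    (hμ : ∀ x ∈ closure (connectedComponentIn (flatBoundary S) p),
      μ - x ∈ closure (connectedComponentIn (flatBoundary S) p)) : m - μ ∈ L := by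
  have hsub : closure (connectedComponentIn (flatBoundary S) p) ⊆ S :=
    (closure_component_subset_frontier p).trans hSc.isClosed.frontier_subset
  have hFc : IsCompact (closure (connectedComponentIn (flatBoundary S) p)) :=
    hSc.of_isClosed_subset isClosed_closure hsub
  obtain ⟨v, hv⟩ := hFc.extremePoints_nonempty ⟨p, subset_closure (mem_connectedComponentIn hp)⟩
  have h1 := hL _ ((isVertex_of_mem_extremePoints hSc.isClosed hv).sub hm)
  have h2 := hL _ (isVertex_of_mem_extremePoints hSc.isClosed (sub_mem_extremePoints hμ hv))
  have := L.sub_mem h1 h2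
  rwa [sub_sub_sub_cancel_right] at this

/-- The pairing of flat boundary points underlying the cancellation of jumps. Let `c F` be twice the
center of the facet `F`, and `m` twice the center of `S`. Translation by `m - c F` carries `F` to
the opposite facet, where `S` lies on the other side, and the translation attached to the opposite
facet is the inverse one. Only points translated to flat boundary points are considered. -/
lemma facet_translation (hSc : IsCompact S) {m : Space d} (hm : ∀ x ∈ S, m - x ∈ S)
    {c : Set (Space d) → Space d}
    (hc : ∀ p ∈ flatBoundary S, ∀ x ∈ closure (connectedComponentIn (flatBoundary S) p),
      c (closure (connectedComponentIn (flatBoundary S) p)) - x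
        ∈ closure (connectedComponentIn (flatBoundary S) p))
    {p q : Space d} (hp : p ∈ flatBoundary S)
    (hq : q = p + (m - c (closure (connectedComponentIn (flatBoundary S) p)))) :
    q ∈ frontier S ∧ (q ∈ flatBoundary S →
      (∀ z, z ∈ inwardDirections S q ↔ -z ∈ inwardDirections S p) ∧
      m - c (closure (connectedComponentIn (flatBoundary S) q))
        = -(m - c (closure (connectedComponentIn (flatBoundary S) p)))) := by
  set C := connectedComponentIn (flatBoundary S) p with hC
  have himg := image_sub_connectedComponentIn hm hp
  set C' := connectedComponentIn (flatBoundary S) (m - p) with hC'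
  have hclos : (fun x => m - x) '' closure C = closure C' := by rw [image_sub_closure, himg]
  have hcC : ∀ x ∈ closure C, c (closure C) - x ∈ closure C := hc p hp
  have hpC : p ∈ closure C := subset_closure (mem_connectedComponentIn hp)
  have hqC : q ∈ closure C' := by
    rw [← hclos]
    exact ⟨_, hcC p hpC, by rw [hq]; dsimp only; abel⟩
  refine ⟨closure_component_subset_frontier _ hqC, fun hqG => ?_⟩
  have hqC' : q ∈ C' := mem_connectedComponentIn_of_mem_closure hqC hqG
  have hCq : connectedComponentIn (flatBoundary S) q = C' := (connectedComponentIn_eq hqC').symm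
  constructor
  · intro z
    rw [inwardDirections_eq_of_mem_connectedComponentIn hqC', mem_inwardDirections_sub_iff hm]
  · rw [hCq]
    have hsub : closure C' ⊆ S :=
      (closure_component_subset_frontier _).trans hSc.isClosed.frontier_subset
    have h1 : c (closure C') = m + m - c (closure C) := by
      refine eq_of_forall_sub_mem (hSc.isBounded.subset hsub) ⟨q, hqC⟩
        (hc (m - p) (sub_mem_flatBoundary hm hp)) fun x hx => ?_
      rw [← hclos] at hx ⊢
      obtain ⟨y, hy, rfl⟩ := hx
      exact ⟨_, hcC y hy, by dsimp only; abel⟩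
    rw [h1]; abel

end Facets

/-! ### Hyperplanes covering the boundary -/

section Hyperplanes

variable {d : ℕ} {S : Set (Space d)}

/-- An affine hyperplane of `ℝ^d`. -/
def IsHyperplane (H : Set (Space d)) : Prop :=
  ∃ n : Space d, n ≠ 0 ∧ ∃ c : ℝ, H = {x | inner ℝ n x = c}

lemma IsHyperplane.isClosed {H : Set (Space d)} (h : IsHyperplane H) : IsClosed H := by
  obtain ⟨n, -, c, rfl⟩ := h
  exact isClosed_eq (by fun_prop) continuous_const

lemma IsHyperplane.volume_eq_zero {H : Set (Space d)} (h : IsHyperplane H) : volume H = 0 := by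
  obtain ⟨n, hn, c, rfl⟩ := h
  exact volume_hyperplane hn c

lemma exists_isHyperplane_of_affineSpan_ne_top {W : Set (Space d)} (hW : W.Nonempty)
    (h : affineSpan ℝ W ≠ ⊤) : ∃ H, IsHyperplane H ∧ (affineSpan ℝ W : Set (Space d)) ⊆ H := by
  obtain ⟨w, hw⟩ := hW
  have hwA : w ∈ affineSpan ℝ W := subset_affineSpan ℝ W hw
  have hdir : (affineSpan ℝ W).direction ≠ ⊤ := fun h' =>
    h ((AffineSubspace.direction_eq_top_iff_of_nonempty ⟨w, hwA⟩).1 h')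
  rw [Ne, ← Submodule.orthogonal_eq_bot_iff, Submodule.eq_bot_iff] at hdir
  push Not at hdir
  obtain ⟨n, hn, hn0⟩ := hdir
  refine ⟨_, ⟨n, hn0, inner ℝ n w, rfl⟩, fun x hx => ?_⟩
  have h1 : x - w ∈ (affineSpan ℝ W).direction := AffineSubspace.vsub_mem_direction hx hwA
  have h2 := (Submodule.mem_orthogonal' _ _).1 hn _ h1
  rw [inner_sub_right, sub_eq_zero] at h2
  exact h2

/-- A boundary point of the convex hull of `V` is, by Carathéodory's theorem, a positive combination
of affinely independent points of `V`, and these cannot span the whole space. -/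
lemma exists_subset_affineSpan_ne_top_of_mem_frontier {V : Set (Space d)} (hV : V.Finite)
    {x : Space d} (hx : x ∈ frontier (convexHull ℝ V)) :
    ∃ W ⊆ V, W.Nonempty ∧ affineSpan ℝ W ≠ ⊤ ∧ x ∈ affineSpan ℝ W := by
  have hx1 : x ∈ convexHull ℝ V := (hV.isClosed_convexHull ℝ).frontier_subset hx
  obtain ⟨ι, _, z, w, hz, hind, hw0, hw1, hwx⟩ := eq_pos_convex_span_of_mem_convexHull hx1
  have hxz : x ∈ convexHull ℝ (Set.range z) := by
    rw [← hwx]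
    exact (convex_convexHull ℝ _).sum_mem (fun i _ => (hw0 i).le) hw1
      fun i _ => subset_convexHull ℝ _ ⟨i, rfl⟩
  refine ⟨Set.range z, hz, convexHull_nonempty_iff.1 ⟨x, hxz⟩, fun htop => ?_,
    convexHull_subset_affineSpan _ hxz⟩
  let B : AffineBasis ι ℝ (Space d) := ⟨z, hind, htop⟩
  have hxB : x = Finset.univ.affineCombination ℝ B w := by
    rw [Finset.affineCombination_eq_linear_combination _ _ _ hw1]
    exact hwx.symm
  have hint : x ∈ interior (convexHull ℝ (Set.range B)) := by
    rw [B.interior_convexHull]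
    intro i
    rw [hxB, B.coord_apply_combination_of_mem (Finset.mem_univ i) hw1]
    exact hw0 i
  exact hx.2 (interior_mono (convexHull_mono hz) hint)

lemma IsPolytope.isCompact (hS : IsPolytope S) : IsCompact S := by
  obtain ⟨𝒱, -, rfl⟩ := hS
  exact 𝒱.finite_toSet.isCompact_biUnion fun V _ => V.finite_toSet.isCompact_convexHull ℝ

lemma IsPolytope.subset_closure_interior (hS : IsPolytope S) : S ⊆ closure (interior S) := by
  obtain ⟨𝒱, hV, rfl⟩ := hS
  refine Set.iUnion₂_subset fun V hVmem => ?_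
  calc convexHull ℝ (V : Set (Space d))
      ⊆ closure (convexHull ℝ (V : Set (Space d))) := subset_closure
    _ = closure (interior (convexHull ℝ (V : Set (Space d)))) :=
        ((convex_convexHull ℝ _).closure_interior_eq_closure_of_nonempty_interior
          (hV V hVmem)).symm
    _ ⊆ _ := closure_mono (interior_mono
        (Set.subset_biUnion_of_mem (u := fun V : Finset (Space d) =>
          convexHull ℝ (V : Set (Space d))) hVmem))

lemma IsPolytope.exists_hyperplanes (hS : IsPolytope S) :
    ∃ 𝓗 : Set (Set (Space d)), 𝓗.Finite ∧ (∀ H ∈ 𝓗, IsHyperplane H) ∧ frontier S ⊆ ⋃₀ 𝓗 := by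
  classical
  have hclosed := hS.isCompact.isClosed
  obtain ⟨𝒱, hV, hSV⟩ := hS
  have hex : ∀ W : Set (Space d), ∃ H, (W.Nonempty ∧ affineSpan ℝ W ≠ ⊤) →
      IsHyperplane H ∧ (affineSpan ℝ W : Set (Space d)) ⊆ H := fun W => by
    by_cases h : W.Nonempty ∧ affineSpan ℝ W ≠ ⊤
    · obtain ⟨H, hH⟩ := exists_isHyperplane_of_affineSpan_ne_top h.1 h.2
      exact ⟨H, fun _ => hH⟩
    · exact ⟨∅, fun h' => absurd h' h⟩
  choose hyp hhyp using hex
  let 𝓦 : Set (Set (Space d)) :=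
    {W | W ∈ (⋃ V ∈ 𝒱, 𝒫 (V : Set (Space d))) ∧ W.Nonempty ∧ affineSpan ℝ W ≠ ⊤}
  have h𝓦 : 𝓦.Finite :=
    (𝒱.finite_toSet.biUnion fun V _ => V.finite_toSet.powerset).subset fun W hW => hW.1
  refine ⟨hyp '' 𝓦, h𝓦.image _, ?_, fun x hx => ?_⟩
  · rintro _ ⟨W, hW, rfl⟩
    exact (hhyp W hW.2).1
  · have hxS : x ∈ S := hclosed.frontier_subset hx
    have hxS' := hxS
    rw [hSV] at hxS'
    obtain ⟨V, hVmem, hxV⟩ := Set.mem_iUnion₂.1 hxS'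
    have hxfr : x ∈ frontier (convexHull ℝ (V : Set (Space d))) := by
      refine ⟨subset_closure hxV, fun hint => hx.2 (interior_mono ?_ hint)⟩
      rw [hSV]
      exact Set.subset_biUnion_of_mem (u := fun V : Finset (Space d) =>
          convexHull ℝ (V : Set (Space d))) hVmem
    obtain ⟨W, hWV, hWn, hWt, hxW⟩ :=
      exists_subset_affineSpan_ne_top_of_mem_frontier V.finite_toSet hxfr
    exact ⟨hyp W, ⟨W, ⟨Set.mem_iUnion₂.2 ⟨V, hVmem, hWV⟩, hWn, hWt⟩, rfl⟩,
      (hhyp W ⟨hWn, hWt⟩).2 hxW⟩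

lemma subset_or_disjoint_of_isPreconnected {X : Type*} [TopologicalSpace X] {S A : Set X}
    (hA : IsPreconnected A) (h : Disjoint A (frontier S)) : A ⊆ S ∨ A ⊆ Sᶜ := by
  have h1 := isPreconnected_iff_subset_of_disjoint.1 hA (interior S) (closure S)ᶜ isOpen_interior
    isClosed_closure.isOpen_compl ?_ ?_
  · exact h1.imp (fun h => h.trans interior_subset)
      fun h => h.trans (Set.compl_subset_compl.2 subset_closure)
  · intro x hx
    by_contra hne
    simp only [Set.mem_union, Set.mem_compl_iff, not_or, not_not] at hne
    exact Set.disjoint_left.1 h hx ⟨hne.2, hne.1⟩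
  · rw [← Set.disjoint_iff_inter_eq_empty]
    refine Disjoint.mono_right (le_of_eq ?_) disjoint_bot_right
    ext x
    simp only [Set.mem_inter_iff, Set.mem_compl_iff, Set.bot_eq_empty, Set.mem_empty_iff_false,
      iff_false, not_and, not_not]
    exact fun h => subset_closure (interior_subset h)

/-- A closed set containing an open half of a ball contains the points of the ball on the bounding
hyperplane, since these are limits of points of that half. -/
lemma mem_of_halfBall_subset {S : Set (Space d)} (hS : IsClosed S) {x n y : Space d} {ε : ℝ}
    (hn : n ≠ 0) (h : Metric.ball x ε ∩ {y | inner ℝ n (y - x) < (0 : ℝ)} ⊆ S)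
    (hy : y ∈ Metric.ball x ε) (hy0 : inner ℝ n (y - x) ≤ (0 : ℝ)) : y ∈ S := by
  have ht := tendsto_add_smul_nhdsGT y (-n)
  refine hS.mem_of_tendsto ht ?_
  filter_upwards [ht.eventually (Metric.isOpen_ball.mem_nhds hy), self_mem_nhdsWithin] with s hs hs0
  refine h ⟨hs, ?_⟩
  have h1 : 0 < s * ‖n‖ ^ 2 := mul_pos hs0 (by positivity)
  simp only [Set.mem_ofPred_eq]
  rw [add_sub_right_comm, inner_add_right, inner_smul_right, inner_neg_right,
    real_inner_self_eq_norm_sq]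
  linarith

lemma convex_halfBall (x n : Space d) (ε : ℝ) :
    Convex ℝ (Metric.ball x ε ∩ {y | inner ℝ n (y - x) < (0 : ℝ)}) := by
  refine (convex_ball x ε).inter ?_
  have : {y : Space d | inner ℝ n (y - x) < (0 : ℝ)} =
      {y | innerₗ (Space d) n y < inner ℝ n x} := by
    ext y; simp [inner_sub_right]
  rw [this]
  exact convex_halfSpace_lt (innerₗ (Space d) n).isLinear _

/-- A boundary point lying on a single hyperplane of a finite family that covers the boundary is
flat: near it the boundary is contained in that hyperplane, so each side of it is either
contained in `S` or disjoint from `S`, and exactly one of them is contained in `S`. -/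
lemma mem_flatBoundary_of_unique_hyperplane (hS : IsClosed S) (hSi : S ⊆ closure (interior S))
    {𝓗 : Set (Set (Space d))} (hfin : 𝓗.Finite) (hH : ∀ H ∈ 𝓗, IsHyperplane H)
    (hcov : frontier S ⊆ ⋃₀ 𝓗) {x : Space d} (hx : x ∈ frontier S)
    (huniq : ∀ H ∈ 𝓗, ∀ H' ∈ 𝓗, x ∈ H → x ∈ H' → H = H') : x ∈ flatBoundary S := by
  obtain ⟨H, hH𝓗, hxH⟩ := hcov hx
  obtain ⟨n, hn, c, hHeq⟩ := hH H hH𝓗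
  have hclosed : IsClosed (⋃₀ (𝓗 \ {H})) := by
    rw [Set.sUnion_eq_biUnion]
    exact (hfin.subset Set.sdiff_subset).isClosed_biUnion fun H' hH' => (hH H' hH'.1).isClosed
  have hxn : x ∉ ⋃₀ (𝓗 \ {H}) := by
    rintro ⟨H', hH', hxH'⟩
    exact hH'.2 (huniq H' hH'.1 H hH𝓗 hxH' hxH)
  obtain ⟨ε, hε, hball⟩ := Metric.isOpen_iff.1 hclosed.isOpen_compl x hxn
  have hfr : ∀ y ∈ Metric.ball x ε, y ∈ frontier S → inner ℝ n (y - x) = (0 : ℝ) := by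
    intro y hy hyf
    obtain ⟨H', hH', hyH'⟩ := hcov hyf
    have : H' = H := by
      by_contra hne
      exact hball hy ⟨H', ⟨hH', hne⟩, hyH'⟩
    subst this
    rw [hHeq] at hyH' hxH
    rw [inner_sub_right, hyH', hxH, sub_self]
  have hhalf : ∀ m : Space d, (m = n ∨ m = -n) →
      (Metric.ball x ε ∩ {y | inner ℝ m (y - x) < (0 : ℝ)} ⊆ S) ∨
      (Metric.ball x ε ∩ {y | inner ℝ m (y - x) < (0 : ℝ)} ⊆ Sᶜ) := by
    intro m hm
    refine subset_or_disjoint_of_isPreconnected (convex_halfBall x m ε).isPreconnected ?_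
    rw [Set.disjoint_left]
    rintro y ⟨hy, hy'⟩ hyf
    have h0 := hfr y hy hyf
    simp only [Set.mem_ofPred_eq] at hy'
    rcases hm with rfl | rfl
    · exact hy'.ne h0
    · rw [inner_neg_left, h0, neg_zero] at hy'
      exact lt_irrefl _ hy'
  have hmix : ∀ m : Space d, m ≠ 0 → Metric.ball x ε ∩ {y | inner ℝ m (y - x) < (0 : ℝ)} ⊆ S →
      Metric.ball x ε ∩ {y | inner ℝ (-m) (y - x) < (0 : ℝ)} ⊆ Sᶜ → x ∈ flatBoundary S := by
    intro m hm h1 h2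
    refine ⟨m, hm, ?_⟩
    filter_upwards [Metric.ball_mem_nhds x hε] with y hy
    refine ⟨fun hyS => not_lt.1 fun hlt => h2 ⟨hy, ?_⟩ hyS, fun h =>
      mem_of_halfBall_subset hS hm h1 hy h⟩
    simp only [Set.mem_ofPred_eq, inner_neg_left]
    linarith
  rcases hhalf n (Or.inl rfl) with h1 | h1 <;> rcases hhalf (-n) (Or.inr rfl) with h2 | h2
  · exfalso
    refine hx.2 (mem_interior_iff_mem_nhds.2 ?_)
    filter_upwards [Metric.ball_mem_nhds x hε] with y hy
    rcases le_total (inner ℝ n (y - x) : ℝ) 0 with h | h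
    · exact mem_of_halfBall_subset hS hn h1 hy h
    · exact mem_of_halfBall_subset hS (neg_ne_zero.2 hn) h2 hy (by
        rw [inner_neg_left]; linarith)
  · exact hmix n hn h1 h2
  · exact hmix (-n) (neg_ne_zero.2 hn) h2 (by rwa [neg_neg])
  · exfalso
    obtain ⟨y, hy, hyi⟩ := mem_closure_iff.1 (hSi (hS.frontier_subset hx)) _ Metric.isOpen_ball
      (Metric.mem_ball_self hε)
    have ht := tendsto_add_smul_nhdsGT y (-n)
    -- an interior point of `S` in the ball can be moved off the hyperplane
    obtain ⟨s, hs1, hs2, hs0⟩ := ((ht.eventually (Metric.isOpen_ball.mem_nhds hy)).and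
      ((ht.eventually (isOpen_interior.mem_nhds hyi)).and self_mem_nhdsWithin)).exists
    have hpos : 0 < s * ‖n‖ ^ 2 := mul_pos hs0 (by positivity)
    have hyS := interior_subset hyi
    rcases lt_trichotomy (inner ℝ n (y - x) : ℝ) 0 with h | h | h
    · exact h1 ⟨hy, h⟩ hyS
    · refine h1 ⟨hs1, ?_⟩ (interior_subset hs2)
      simp only [Set.mem_ofPred_eq]
      rw [add_sub_right_comm, inner_add_right, inner_smul_right, inner_neg_right,
        real_inner_self_eq_norm_sq, h]
      linarith
    · refine h2 ⟨hy, ?_⟩ hyS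
      simp only [Set.mem_ofPred_eq, inner_neg_left]
      linarith

/-- Almost every segment from `x` misses the intersection of two distinct hyperplanes not containing
`x`: the endpoints of the other segments lie in the hyperplane of the pencil through `x`. -/
lemma ae_forall_segment_notMem_inter {H₁ H₂ : Set (Space d)} (h₁ : IsHyperplane H₁)
    (h₂ : IsHyperplane H₂) (hne : H₁ ≠ H₂) {x : Space d} (hx₁ : x ∉ H₁) (hx₂ : x ∉ H₂) :
    ∀ᵐ y : Space d, ∀ z ∈ segment ℝ x y, ¬ (z ∈ H₁ ∧ z ∈ H₂) := by
  obtain ⟨n₁, hn₁, c₁, rfl⟩ := h₁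
  obtain ⟨n₂, hn₂, c₂, rfl⟩ := h₂
  simp only [Set.mem_ofPred_eq] at hx₁ hx₂
  set α₁ := inner ℝ n₁ x - c₁ with hα₁
  set α₂ := inner ℝ n₂ x - c₂ with hα₂
  have h₁0 : α₁ ≠ 0 := sub_ne_zero.2 hx₁
  have h₂0 : α₂ ≠ 0 := sub_ne_zero.2 hx₂
  have hm : α₂ • n₁ - α₁ • n₂ ≠ 0 := by
    intro h
    have key : ∀ y, α₂ * (inner ℝ n₁ y - c₁) = α₁ * (inner ℝ n₂ y - c₂) := by
      intro y
      have e : inner ℝ (α₂ • n₁ - α₁ • n₂) (y - x) = (0 : ℝ) := by rw [h, inner_zero_left]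
      simp only [inner_sub_left, inner_sub_right, real_inner_smul_left] at e
      rw [hα₁, hα₂] at e ⊢
      linarith
    refine hne (Set.ext fun y => ?_)
    simp only [Set.mem_ofPred_eq]
    constructor
    · intro hy
      have := key y
      rw [hy, sub_self, mul_zero] at this
      exact sub_eq_zero.1 ((mul_eq_zero.1 this.symm).resolve_left h₁0)
    · intro hy
      have := key y
      rw [hy, sub_self, mul_zero] at this
      exact sub_eq_zero.1 ((mul_eq_zero.1 this).resolve_left h₂0)
  have hnull := volume_hyperplane hm (inner ℝ (α₂ • n₁ - α₁ • n₂) x)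
  filter_upwards [compl_mem_ae_iff.2 hnull] with y hy z hz hzH
  refine hy ?_
  rw [segment_eq_image'] at hz
  obtain ⟨s, -, rfl⟩ := hz
  obtain ⟨e₁, e₂⟩ := hzH
  simp only [inner_add_right, inner_smul_right] at e₁ e₂
  have hs : s ≠ 0 := by
    rintro rfl
    exact hx₁ (by simpa using e₁)
  have e3 : s * inner ℝ (α₂ • n₁ - α₁ • n₂) (y - x) = (0 : ℝ) := by
    simp only [inner_sub_left, real_inner_smul_left]
    have f₁ : s * inner ℝ n₁ (y - x) = -α₁ := by rw [hα₁]; linarith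
    have f₂ : s * inner ℝ n₂ (y - x) = -α₂ := by rw [hα₂]; linarith
    linear_combination α₂ * f₁ - α₁ * f₂
  have e4 := (mul_eq_zero.1 e3).resolve_left hs
  rw [inner_sub_right, sub_eq_zero] at e4
  exact e4

end Hyperplanes

/-! ### The covering multiplicity -/

section Counting

variable {d : ℕ} {S : Set (Space d)}

open Classical in
/-- Twice the indicator function of `S`, with the value halved on the boundary of a closed set. -/
noncomputable def coverWeight (S : Set (Space d)) (y : Space d) : ℤ :=
  (if y ∈ S then 1 else 0) + (if y ∈ interior S then 1 else 0)

lemma coverWeight_of_notMem {y : Space d} (hy : y ∉ S) : coverWeight S y = 0 := by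
  rw [coverWeight, if_neg hy, if_neg fun h => hy (interior_subset h), add_zero]

open Classical in
/-- The increment of `coverWeight S` in the direction `z` from a flat boundary point `p`: it is
`1`, `0` or `-1` as `z` points strictly inwards, along the boundary or outwards. -/
noncomputable def flatJump (S : Set (Space d)) (p z : Space d) : ℤ :=
  (if z ∈ inwardDirections S p then 1 else 0) - (if -z ∈ inwardDirections S p then 1 else 0)

lemma eventually_coverWeight_of_mem_flatBoundary {p : Space d} (hp : p ∈ flatBoundary S) :
    ∀ᶠ y in 𝓝 p, coverWeight S y = coverWeight S p + flatJump S p (y - p) := by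
  obtain ⟨n, hn⟩ := hp
  have hn' : IsFlatNormal S p n := hn
  have hp1 : coverWeight S p = 1 := by
    rw [coverWeight, if_pos hn'.mem, if_neg hn'.notMem_interior, add_zero]
  filter_upwards [hn'.2, hn'.eventually_mem_interior_iff] with y h1 h2
  rw [hp1, coverWeight, flatJump]
  simp only [h1, h2, hn'.mem_inwardDirections_iff, inner_neg_right, Left.neg_nonpos_iff]
  rcases lt_trichotomy (inner ℝ n (y - p) : ℝ) 0 with h | h | h
  · simp [h, h.le, h.not_ge]
  · simp [h]
  · simp [h.le, h.not_ge, h.not_gt]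

lemma eventually_coverWeight_of_notMem_frontier {p : Space d} (hp : p ∉ frontier S) :
    ∀ᶠ y in 𝓝 p, coverWeight S y = coverWeight S p := by
  have h : p ∈ interior S ∨ p ∈ (closure S)ᶜ := by
    by_contra hne
    simp only [Set.mem_compl_iff, not_or, not_not] at hne
    exact hp ⟨hne.2, hne.1⟩
  rcases h with h | h
  · have h1 : ∀ y ∈ interior S, coverWeight S y = 2 := fun y hy => by
      rw [coverWeight, if_pos (interior_subset hy), if_pos hy]; norm_num
    filter_upwards [isOpen_interior.mem_nhds h] with y hy
    rw [h1 y hy, h1 p h]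
  · have h1 : ∀ y ∈ (closure S)ᶜ, coverWeight S y = 0 := fun y hy =>
      coverWeight_of_notMem fun h => hy (subset_closure h)
    filter_upwards [isClosed_closure.isOpen_compl.mem_nhds h] with y hy
    rw [h1 y hy, h1 p h]

variable (L : Submodule ℤ (Space d))

/-- The covering multiplicity of `x` by the translates of `S` by the lattice, counted with the
weight `coverWeight`. -/
noncomputable def coverCount (S : Set (Space d)) (x : Space d) : ℤ :=
  ∑ᶠ l : L, coverWeight S (l +ᵥ x)

open scoped Pointwise in
lemma finite_setOf_exists_vadd_mem [DiscreteTopology L] (hS : Bornology.IsBounded S)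
    {A : Set (Space d)} (hA : Bornology.IsBounded A) :
    {l : L | ∃ y ∈ A, l +ᵥ y ∈ S}.Finite := by
  have hd : DiscreteTopology L.toAddSubgroup := inferInstanceAs (DiscreteTopology L)
  have hcl : IsClosed (L : Set (Space d)) := AddSubgroup.isClosed_of_discrete (H := L.toAddSubgroup)
  have hfin : ((S - A) ∩ (L : Set (Space d))).Finite :=
    Metric.finite_isBounded_inter_isClosed DiscreteTopology.isDiscrete
      (Bornology.IsBounded.sub hS hA) hcl
  refine (hfin.preimage Subtype.val_injective.injOn).subset ?_
  rintro l ⟨y, hy, hly⟩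
  exact ⟨⟨_, hly, y, hy, by simp [Submodule.vadd_def]⟩, l.2⟩

/-- The multiplicity does not jump at a point whose lattice translates meet the boundary of `S` only
at flat points: the jumps cancel in pairs of opposite facets. -/
lemma eventually_coverCount_eq [DiscreteTopology L] (hSc : IsCompact S)
    (hsymm : IsCentrallySymmetric S)
    (hfacets : ∀ F : Set (Space d), IsFacet S F → IsCentrallySymmetric F)
    (hL : ∀ x, IsVertex S x → x ∈ L) {x : Space d}
    (hx : ∀ l : L, l +ᵥ x ∈ frontier S → l +ᵥ x ∈ flatBoundary S) :
    ∀ᶠ y in 𝓝 x, coverCount L S y = coverCount L S x := by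
  classical
  obtain ⟨m, hm⟩ := hsymm.exists_forall_sub_mem
  have hcex : ∀ F : Set (Space d), ∃ μ : Space d, IsFacet S F → ∀ x ∈ F, μ - x ∈ F := by
    intro F
    by_cases hF : IsFacet S F
    · obtain ⟨μ, hμ⟩ := (hfacets F hF).exists_forall_sub_mem
      exact ⟨μ, fun _ => hμ⟩
    · exact ⟨0, fun h => absurd h hF⟩
  choose c hcF using hcex
  have hc : ∀ p ∈ flatBoundary S, ∀ x ∈ closure (connectedComponentIn (flatBoundary S) p),
      c (closure (connectedComponentIn (flatBoundary S) p)) - x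
        ∈ closure (connectedComponentIn (flatBoundary S) p) :=
    fun p hp => hcF _ ⟨p, hp, rfl⟩
  have hfin := finite_setOf_exists_vadd_mem L hSc.isBounded
    (Metric.isBounded_ball (x := x) (r := 1))
  set N := hfin.toFinset with hN
  have hsum : ∀ y ∈ Metric.ball x 1, coverCount L S y = ∑ l ∈ N, coverWeight S (l +ᵥ y) := by
    intro y hy
    refine finsum_eq_sum_of_support_subset _ fun l hl => ?_
    rw [hN, Set.Finite.coe_toFinset]
    refine ⟨y, hy, by_contra fun hne => hl (coverWeight_of_notMem hne)⟩
  have hxb : x ∈ Metric.ball x 1 := Metric.mem_ball_self one_pos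
  have hlocal : ∀ l : L, ∀ᶠ y in 𝓝 x, coverWeight S (l +ᵥ y) = coverWeight S (l +ᵥ x)
      + if l +ᵥ x ∈ flatBoundary S then flatJump S (l +ᵥ x) (y - x) else 0 := by
    intro l
    have ht : Tendsto (fun y : Space d => l +ᵥ y) (𝓝 x) (𝓝 (l +ᵥ x)) :=
      (by fun_prop : Continuous fun y : Space d => (l : Space d) + y).tendsto x
    by_cases hl : l +ᵥ x ∈ flatBoundary S
    · filter_upwards [ht.eventually (eventually_coverWeight_of_mem_flatBoundary hl)] with y hy
      rw [if_pos hl, hy]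
      congr 2
      simp [Submodule.vadd_def]
    · filter_upwards [ht.eventually (eventually_coverWeight_of_notMem_frontier
        fun h => hl (hx l h))] with y hy
      rw [if_neg hl, hy, add_zero]
  have hcancel : ∀ z, ∑ l ∈ N with l +ᵥ x ∈ flatBoundary S, flatJump S (l +ᵥ x) z = 0 := by
    intro z
    -- the translation taking the facet through `l +ᵥ x` to the opposite one
    let τ : L → Space d := fun l =>
      m - c (closure (connectedComponentIn (flatBoundary S) (l +ᵥ x)))
    have hτL : ∀ l : L, l +ᵥ x ∈ flatBoundary S → τ l ∈ L := fun l hl =>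
      sub_mem_of_facet hSc hL hm hl (hc _ hl)
    let σ : ∀ l ∈ N.filter (fun l => l +ᵥ x ∈ flatBoundary S), L := fun l hl =>
      l + ⟨τ l, hτL l (Finset.mem_filter.1 hl).2⟩
    have hσ : ∀ l hl, σ l hl +ᵥ x = (l +ᵥ x) + τ l := fun l hl => by
      simp only [σ, Submodule.vadd_def, vadd_eq_add, Submodule.coe_add]; abel
    have hpair : ∀ l hl, σ l hl +ᵥ x ∈ flatBoundary S ∧
        (∀ z, z ∈ inwardDirections S (σ l hl +ᵥ x) ↔ -z ∈ inwardDirections S (l +ᵥ x)) ∧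
        τ (σ l hl) = -τ l := fun l hl => by
      obtain ⟨h1, h2⟩ := facet_translation hSc hm hc (Finset.mem_filter.1 hl).2 (hσ l hl)
      have h3 := hx _ h1
      exact ⟨h3, h2 h3⟩
    have hjump : ∀ l hl, flatJump S (σ l hl +ᵥ x) z = -flatJump S (l +ᵥ x) z := fun l hl => by
      simp only [flatJump, (hpair l hl).2.1, neg_neg, neg_sub]
    refine Finset.sum_involution σ (fun l hl => ?_) (fun l hl h0 heq => ?_) (fun l hl => ?_)
      fun l hl => ?_
    · rw [hjump l hl, add_neg_cancel]
    · have := hjump l hl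
      rw [heq] at this
      omega
    · refine Finset.mem_filter.2 ⟨?_, (hpair l hl).1⟩
      rw [hN, Set.Finite.mem_toFinset]
      exact ⟨x, hxb, flatBoundary_subset (hpair l hl).1⟩
    · refine Subtype.ext ?_
      have h1 := (hpair l hl).2.2
      change ((l : Space d) + τ l) + τ (σ l hl) = l
      rw [h1]; abel
  filter_upwards [Metric.ball_mem_nhds x one_pos, (Filter.eventually_all_finset N).2
    fun l _ => hlocal l] with y hy hyl
  rw [hsum y hy, hsum x hxb, Finset.sum_congr rfl hyl, Finset.sum_add_distrib,
    ← Finset.sum_filter, hcancel, add_zero]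

lemma coverCount_eq_two_mul_ncard [DiscreteTopology L] (hSc : IsCompact S) {x : Space d}
    (hx : ∀ l : L, l +ᵥ x ∉ frontier S) :
    coverCount L S x = 2 * ({l : L | l +ᵥ x ∈ S}.ncard : ℤ) := by
  classical
  have hfin : {l : L | l +ᵥ x ∈ S}.Finite := by
    refine (finite_setOf_exists_vadd_mem L hSc.isBounded
      (Bornology.isBounded_singleton (x := x))).subset ?_
    exact fun l hl => ⟨x, rfl, hl⟩
  have hw : ∀ l : L, coverWeight S (l +ᵥ x) = if l +ᵥ x ∈ S then 2 else 0 := by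
    intro l
    by_cases h : l +ᵥ x ∈ S
    · have : l +ᵥ x ∈ interior S := by_contra fun hne => hx l ⟨subset_closure h, hne⟩
      rw [coverWeight, if_pos h, if_pos h, if_pos this]; norm_num
    · rw [coverWeight_of_notMem h, if_neg h]
  rw [coverCount, finsum_eq_sum_of_support_subset (s := hfin.toFinset),
    Set.ncard_eq_toFinset_card _ hfin,
    Finset.sum_congr rfl fun l hl => (hw l).trans (if_pos ((Set.Finite.mem_toFinset hfin).1 hl)),
    Finset.sum_const, nsmul_eq_mul, mul_comm]
  intro l hl
  rw [Set.Finite.coe_toFinset]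
  by_contra hne
  exact hl ((hw l).trans (if_neg hne))

/-- A centrally symmetric polytope with centrally symmetric facets and with vertices in a lattice
covers almost every point the same number of times by its lattice translates. -/
theorem exists_multitile [DiscreteTopology L] [IsZLattice ℝ L] (hS : IsPolytope S)
    (hsymm : IsCentrallySymmetric S)
    (hfacets : ∀ F : Set (Space d), IsFacet S F → IsCentrallySymmetric F)
    (hL : ∀ x, IsVertex S x → x ∈ L) :
    ∃ k : ℕ, ∀ᵐ x : Space d, {l : L | l +ᵥ x ∈ S}.ncard = k := by
  have hSc := hS.isCompact
  obtain ⟨𝓗, hfin, hH, hcov⟩ := hS.exists_hyperplanes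
  have hcount : Countable L := inferInstance
  have hgen : ∀ᵐ x : Space d, ∀ l : L, ∀ H ∈ 𝓗, l +ᵥ x ∉ H := by
    refine ae_all_iff.2 fun l => (ae_ball_iff hfin.countable).2 fun H hH𝓗 => ?_
    have h1 := (measurePreserving_vadd l (volume : Measure (Space d))).quasiMeasurePreserving
    exact h1.ae (compl_mem_ae_iff.2 (hH H hH𝓗).volume_eq_zero)
  have hgenfr : ∀ x : Space d, (∀ l : L, ∀ H ∈ 𝓗, l +ᵥ x ∉ H) → ∀ l : L, l +ᵥ x ∉ frontier S :=
    fun x hx l hl => by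
      obtain ⟨H, hH𝓗, hxH⟩ := hcov hl
      exact hx l H hH𝓗 hxH
  obtain ⟨x₀, hx₀⟩ := hgen.exists
  have hseg : ∀ᵐ y : Space d, ∀ z ∈ segment ℝ x₀ y, ∀ l : L,
      l +ᵥ z ∈ frontier S → l +ᵥ z ∈ flatBoundary S := by
    have h1 : ∀ᵐ y : Space d, ∀ l : L, ∀ H ∈ 𝓗, ∀ H' ∈ 𝓗, H ≠ H' →
        ∀ z ∈ segment ℝ (l +ᵥ x₀) (l +ᵥ y), ¬ (z ∈ H ∧ z ∈ H') := by
      refine ae_all_iff.2 fun l => (ae_ball_iff hfin.countable).2 fun H hH𝓗 =>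
        (ae_ball_iff hfin.countable).2 fun H' hH'𝓗 => ?_
      by_cases hne : H = H'
      · simp [hne]
      · have h1 := (measurePreserving_vadd l (volume : Measure (Space d))).quasiMeasurePreserving
        refine (h1.ae (ae_forall_segment_notMem_inter (hH H hH𝓗) (hH H' hH'𝓗) hne
          (hx₀ l H hH𝓗) (hx₀ l H' hH'𝓗))).mono fun y hy _ => hy
    filter_upwards [h1] with y hy z hz l hl
    refine mem_flatBoundary_of_unique_hyperplane hSc.isClosed hS.subset_closure_interior hfin hH
      hcov hl fun H hH𝓗 H' hH'𝓗 hzH hzH' => by_contra fun hne => ?_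
    refine hy l H hH𝓗 H' hH'𝓗 hne _ ?_ ⟨hzH, hzH'⟩
    rw [Submodule.vadd_def, Submodule.vadd_def, Submodule.vadd_def]
    exact (mem_segment_translate ℝ _).2 hz
  refine ⟨{l : L | l +ᵥ x₀ ∈ S}.ncard, ?_⟩
  filter_upwards [hgen, hseg] with y hy hys
  have h1 : coverCount L S y = coverCount L S x₀ := by
    refine (convex_segment x₀ y).isPreconnected.induction₂
      (fun a b => coverCount L S a = coverCount L S b) ?_
      (fun _ _ _ _ _ _ h1 h2 => h1.trans h2) (fun _ _ _ _ h1 => h1.symm)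
      (right_mem_segment ℝ x₀ y) (left_mem_segment ℝ x₀ y)
    intro z hz
    exact ((eventually_coverCount_eq L hSc hsymm hfacets hL (hys z hz)).filter_mono
      nhdsWithin_le_nhds).mono fun _ h => h.symm
  rw [coverCount_eq_two_mul_ncard L hSc (hgenfr y hy),
    coverCount_eq_two_mul_ncard L hSc (hgenfr x₀ hx₀)] at h1
  exact_mod_cast mul_left_cancel₀ two_ne_zero h1

end Counting

end RieszExp

theorem corollary2 (d : ℕ) (L : Submodule ℤ (RieszExp.Space d)) [DiscreteTopology L]
    [IsZLattice ℝ L] (S : Set (RieszExp.Space d))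
    (hS : RieszExp.IsPolytope S)
    (hsymm : RieszExp.IsCentrallySymmetric S)
    (hfacets : ∀ F : Set (RieszExp.Space d), RieszExp.IsFacet S F →
      RieszExp.IsCentrallySymmetric F)
    (hvertices : ∀ x : RieszExp.Space d, RieszExp.IsVertex S x → x ∈ L) :
    ∃ Γ : Set (RieszExp.Space d), RieszExp.IsRieszBasisOfExponentials S Γ := by
  obtain ⟨k, hk⟩ := RieszExp.exists_multitile L hS hsymm hfacets hvertices
  exact RieszExp.exists_isRieszBasisOfExponentials_of_multitile L
    hS.isCompact.isClosed.measurableSet hS.isCompact.isBounded hk
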